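/- **Setting.** Let $F$ be a field of characteristic $0$ (for instance $\mathbb{C}$). For an integer $k\ge 1$ let $\Pi_{2k}$ be the set of set partitions of $\{1,\dots,2k\}$, where $1,\dots,k$ are drawn as a bottom row and $k+1,\dots,2k$ as a top row of vertices (vertex $i$ below vertex $k+i$), ordered by refinement: $\pi\preceq\varrho$ if every block of $\pi$ lies in a block of $\varrho$. Let $\Pi_{2k-1}\subset\Pi_{2k}$ be the set of those partitions for which $k$ and $2k$ are in the same block. For $n\ge 1$ the partition algebra $\mathsf P_k(n)$ has $F$-basis $\{d_\pi\mid\pi\in\Pi_{2k}\}$ (the diagram basis) and multiplication $d_{\pi_1}d_{\pi_2}=n^{[\pi_1*\pi_2]}d_{\pi_1*\pi_2}$: the diagram of $\pi_1$ is placed above that of $\pi_2$, the bottom row of the former is identified with the top row of the latter, the $[\pi_1*\pi_2]$ connected components lying entirely in the middle row are removed, and $\pi_1*\pi_2$ is the resulting partition of the outer two rows. The orbit basis $\{x_\pi\mid\pi\in\Pi_{2k}\}$ is defined by $d_\pi=\sum_{\pi\preceq\varrho}x_\varrho$. The algebra $\mathsf P_{k-\frac12}(n)\subset\mathsf P_k(n)$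 is the span of $\{d_\pi\mid\pi\in\Pi_{2k-1}\}$. Let $\mathsf M_n$ be the $n$-dimensional permutation module of the symmetric group $\mathsf S_n$, with basis $u_1,\dots,u_n$. The representation $\Phi_{k,n}:\mathsf P_k(n)\to\operatorname{End}(\mathsf M_n^{\otimes k})$ is the algebra homomorphism for which the coefficient of $u_{r_{k+1}}\otimes\cdots\otimes u_{r_{2k}}$ in $\Phi_{k,n}(x_\pi)(u_{r_1}\otimes\cdots\otimes u_{r_k})$ is $1$ if, for all $a,b\in\{1,\dots,2k\}$, $r_a=r_b$ holds if and only if $a$ and $b$ are in the same block of $\pi$, and $0$ otherwise. The representation $\Phi_{k-\frac12,n}:\mathsf P_{k-\frac12}(n)\to\operatorname{End}(\mathsf M_n^{\otimes(k-1)})$ is obtained from $\Phi_{k,n}$ by restricting to $\mathsf P_{k-\frac12}(n)$ and to $\mathsf M_n^{\otimes(k-1)}\cong\mathsf M_n^{\otimes(k-1)}\otimes u_n\subseteq\mathsf M_n^{\otimes k}$. For integers $k,n\ge 1$ with $2k>n$ let $\mathsf e_{k,n}=x_{\pi_{k,n}}\in\mathsf P_k(n)$, where $\pi_{k,n}\in\Pi_{2k}$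 is the following set partition. If $n\ge k>n/2$, then $\{i\}$ and $\{k+i\}$ are blocks for $1\le i\le n+1-k$, and $\{i,k+i\}$ is a block for each of the remaining $2k-n-1$ values $n+2-k\le i\le k$. If $k>n$, then the blocks are $\{i,k+i\}$ for $1\le i\le k$. If $2k-1>n$, let $\mathsf e_{k-\frac12,n}=\mathsf e_{k,n}$, which lies in $\mathsf P_{k-\frac12}(n)$. **Theorem.** For every integer $n\ge 1$ and every $k\in\frac12\mathbb Z_{\ge 1}$ with $2k>n$, the kernel of $\Phi_{k,n}$ is the two-sided ideal of $\mathsf P_k(n)$ generated by $\mathsf e_{k,n}$: $$\ker\Phi_{k,n}=\langle\mathsf e_{k,n}\rangle .$$ -/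

import Mathlib

open scoped TensorProduct

namespace PartitionAlgebra

/-- The `2k` vertices of a diagram with two rows of `k` vertices: `Sum.inl i` is the `i`-th bottom
vertex and `Sum.inr i` the `i`-th top vertex. -/
abbrev Vertex (k : ℕ) : Type := Fin k ⊕ Fin k

/-- Set partitions of the `2k` vertices, as equivalence relations (the blocks are the classes).
The order `π ≤ ρ` of `Setoid` says that `π` refines `ρ`, i.e. `ρ` is a coarsening of `π`. -/
abbrev SetPartition (k : ℕ) : Type := Setoid (Vertex k)

instance (k : ℕ) : Finite (SetPartition k) :=
  Finite.of_injective (fun (r : SetPartition k) (x y : Vertex k) => r x y) fun _ _ h =>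
    Setoid.ext fun x y => iff_of_eq (congrFun (congrFun h x) y)

noncomputable instance (k : ℕ) : Fintype (SetPartition k) := Fintype.ofFinite _

/-- The three rows (bottom, middle, top) obtained by placing one diagram above another. -/
abbrev Vertex3 (k : ℕ) : Type := Fin k ⊕ (Fin k ⊕ Fin k)

/-- The lower diagram occupies the bottom and the middle row. -/
def lower {k : ℕ} : Vertex k → Vertex3 k
  | Sum.inl i => Sum.inl i
  | Sum.inr i => Sum.inr (Sum.inl i)

/-- The upper diagram occupies the middle and the top row. -/
def upper {k : ℕ} : Vertex k → Vertex3 k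
  | Sum.inl i => Sum.inr (Sum.inl i)
  | Sum.inr i => Sum.inr (Sum.inr i)

/-- The bottom and the top row. -/
def outer {k : ℕ} : Vertex k → Vertex3 k
  | Sum.inl i => Sum.inl i
  | Sum.inr i => Sum.inr (Sum.inr i)

/-- A vertex of the middle row. -/
def middle {k : ℕ} (i : Fin k) : Vertex3 k := Sum.inr (Sum.inl i)

/-- The connected components of the three-row diagram with `π₁` placed above `π₂`. -/
def stack {k : ℕ} (π₁ π₂ : SetPartition k) : Setoid (Vertex3 k) :=
  Relation.EqvGen.setoid fun x y =>
    (∃ a b, π₁ a b ∧ upper a = x ∧ upper b = y) ∨ (∃ a b, π₂ a b ∧ lower a = x ∧ lower b = y)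

/-- The concatenation `π₁ ∗ π₂`. -/
def concat {k : ℕ} (π₁ π₂ : SetPartition k) : SetPartition k :=
  Setoid.comap outer (stack π₁ π₂)

/-- The connected components of the stacked diagram that lie entirely in the middle row. -/
abbrev Inner {k : ℕ} (π₁ π₂ : SetPartition k) : Type :=
  {c : Quotient (stack π₁ π₂) // ∀ x, Quotient.mk (stack π₁ π₂) x = c → ∃ i, x = middle i}

/-- The number `[π₁ ∗ π₂]` of components removed from the middle row. -/
noncomputable def removed {k : ℕ} (π₁ π₂ : SetPartition k) : ℕ := Nat.card (Inner π₁ π₂)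

/-- The identity partition, with blocks `{i, i'}` for `i` at the bottom, `i'` above it on top. -/
def idPart (k : ℕ) : SetPartition k := Setoid.ker (Sum.elim id id)

end PartitionAlgebra

/-- The partition algebra `P_k(ξ)`: formal linear combinations of set partitions. The parameter
`ξ` enters through the multiplication. -/
def PartitionAlgebra (F : Type*) [Field F] (k : ℕ) (_ξ : F) : Type _ :=
  PartitionAlgebra.SetPartition k →₀ F

namespace PartitionAlgebra

section Algebra

variable {F : Type*} [Field F] {k : ℕ} {ξ : F}

noncomputable instance : AddCommGroup (PartitionAlgebra F k ξ) :=
  inferInstanceAs (AddCommGroup (SetPartition k →₀ F))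

noncomputable instance : Module F (PartitionAlgebra F k ξ) :=
  inferInstanceAs (Module F (SetPartition k →₀ F))

/-- The diagram basis. -/
noncomputable def diagramBasis (F : Type*) [Field F] (k : ℕ) (ξ : F) :
    Module.Basis (SetPartition k) F (PartitionAlgebra F k ξ) :=
  Module.Basis.ofRepr (LinearEquiv.refl F (SetPartition k →₀ F))

/-- The diagram basis element `d_π`. -/
noncomputable def diagram (ξ : F) (π : SetPartition k) : PartitionAlgebra F k ξ :=
  diagramBasis F k ξ π

/-- Diagram multiplication `d_π₁ d_π₂ = ξ ^ [π₁ ∗ π₂] d_{π₁ ∗ π₂}`, extended bilinearly. -/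
noncomputable def mulLin (F : Type*) [Field F] (k : ℕ) (ξ : F) :
    PartitionAlgebra F k ξ →ₗ[F] PartitionAlgebra F k ξ →ₗ[F] PartitionAlgebra F k ξ :=
  (diagramBasis F k ξ).constr F fun π₁ => (diagramBasis F k ξ).constr F fun π₂ =>
    ξ ^ removed π₁ π₂ • diagram ξ (concat π₁ π₂)

noncomputable instance : Mul (PartitionAlgebra F k ξ) := ⟨fun a b => mulLin F k ξ a b⟩

noncomputable instance : One (PartitionAlgebra F k ξ) := ⟨diagram ξ (idPart k)⟩

theorem mul_def (a b : PartitionAlgebra F k ξ) : a * b = mulLin F k ξ a b := rfl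

theorem one_def : (1 : PartitionAlgebra F k ξ) = diagram ξ (idPart k) := rfl

theorem diagram_mul (π₁ π₂ : SetPartition k) :
    diagram ξ π₁ * diagram ξ π₂ = ξ ^ removed π₁ π₂ • diagram ξ (concat π₁ π₂) := by
  rw [mul_def, mulLin, diagram, Module.Basis.constr_basis, diagram, Module.Basis.constr_basis]

end Algebra

section Combinatorics

variable {k : ℕ}

/-- The labeling of the three rows by `b` (bottom), `m` (middle) and `t` (top). -/
def label3 {n : ℕ} (b m t : Fin k → Fin n) : Vertex3 k → Fin n := Sum.elim b (Sum.elim m t)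

theorem stack_le_iff {α : Type*} (π₁ π₂ : SetPartition k) (f : Vertex3 k → α) :
    stack π₁ π₂ ≤ Setoid.ker f ↔
      π₁ ≤ Setoid.ker (f ∘ upper) ∧ π₂ ≤ Setoid.ker (f ∘ lower) := by
  constructor
  · intro h
    exact ⟨fun {a b} hab => h (Relation.EqvGen.rel _ _ (Or.inl ⟨a, b, hab, rfl, rfl⟩)),
      fun {a b} hab => h (Relation.EqvGen.rel _ _ (Or.inr ⟨a, b, hab, rfl, rfl⟩))⟩
  · rintro ⟨h1, h2⟩
    refine Setoid.eqvGen_le ?_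
    rintro x y (⟨a, b, hab, rfl, rfl⟩ | ⟨a, b, hab, rfl, rfl⟩)
    · exact h1 hab
    · exact h2 hab

theorem label3_upper {n : ℕ} (b m t : Fin k → Fin n) : label3 b m t ∘ upper = Sum.elim m t := by
  funext x; cases x <;> rfl

theorem label3_lower {n : ℕ} (b m t : Fin k → Fin n) : label3 b m t ∘ lower = Sum.elim b m := by
  funext x; cases x <;> rfl

theorem label3_outer {n : ℕ} (b m t : Fin k → Fin n) (v : Vertex k) :
    label3 b m t (outer v) = Sum.elim b t v := by
  cases v <;> rfl

theorem outer_ne_middle (v : Vertex k) (i : Fin k) : outer v ≠ middle i := by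
  cases v <;> simp [outer, middle]

theorem eq_outer_of_forall_ne_middle (x : Vertex3 k) (h : ∀ i, x ≠ middle i) :
    ∃ v, outer v = x := by
  rcases x with i | i | i
  · exact ⟨Sum.inl i, rfl⟩
  · exact absurd rfl (h i)
  · exact ⟨Sum.inr i, rfl⟩

/-- The number of middle labelings compatible with two stacked diagrams. -/
theorem card_middle {n : ℕ} (π₁ π₂ : SetPartition k) (b t : Fin k → Fin n)
    (h : concat π₁ π₂ ≤ Setoid.ker (Sum.elim b t)) :
    Nat.card {m : Fin k → Fin n // stack π₁ π₂ ≤ Setoid.ker (label3 b m t)} =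
      n ^ removed π₁ π₂ := by
  classical
  have key : ∀ c : Quotient (stack π₁ π₂),
      (¬ ∀ x, Quotient.mk (stack π₁ π₂) x = c → ∃ i, x = middle i) →
      ∃ v, Quotient.mk (stack π₁ π₂) (outer v) = c := by
    intro c hc
    push Not at hc
    obtain ⟨x, hx, hne⟩ := hc
    obtain ⟨v, rfl⟩ := eq_outer_of_forall_ne_middle x hne
    exact ⟨v, hx⟩
  let fwd : {m : Fin k → Fin n // stack π₁ π₂ ≤ Setoid.ker (label3 b m t)} →
      (Inner π₁ π₂ → Fin n) := fun m c => label3 b m.1 t c.1.out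
  have hval : ∀ (m : {m : Fin k → Fin n // stack π₁ π₂ ≤ Setoid.ker (label3 b m t)}) (x y),
      Quotient.mk (stack π₁ π₂) x = Quotient.mk (stack π₁ π₂) y →
      label3 b m.1 t x = label3 b m.1 t y := fun m x y hxy => m.2 (Quotient.exact hxy)
  have hbij : Function.Bijective fwd := by
    constructor
    · intro m m' hmm
      apply Subtype.ext
      funext i
      change label3 b m.1 t (middle i) = label3 b m'.1 t (middle i)
      by_cases hc : ∀ x, Quotient.mk (stack π₁ π₂) x = Quotient.mk (stack π₁ π₂) (middle i) →
          ∃ j, x = middle j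
      · have h1 := congrFun hmm ⟨_, hc⟩
        rw [hval m (middle i) (Quotient.mk (stack π₁ π₂) (middle i)).out (Quotient.out_eq _).symm,
          hval m' (middle i) (Quotient.mk (stack π₁ π₂) (middle i)).out (Quotient.out_eq _).symm]
        exact h1
      · obtain ⟨v, hv⟩ := key _ hc
        rw [← hval m _ _ hv, ← hval m' _ _ hv, label3_outer, label3_outer]
    · intro g
      let G : Quotient (stack π₁ π₂) → Fin n := fun c =>
        if hc : ∀ x, Quotient.mk (stack π₁ π₂) x = c → ∃ i, x = middle i then g ⟨c, hc⟩
        else Sum.elim b t (key c hc).choose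
      have hG : ∀ x, label3 b (fun i => G (Quotient.mk (stack π₁ π₂) (middle i))) t x =
          G (Quotient.mk (stack π₁ π₂) x) := by
        intro x
        by_cases hx : ∃ i, x = middle i
        · obtain ⟨i, rfl⟩ := hx
          rfl
        · push Not at hx
          obtain ⟨v, rfl⟩ := eq_outer_of_forall_ne_middle x hx
          have hc : ¬ ∀ x, Quotient.mk (stack π₁ π₂) x = Quotient.mk (stack π₁ π₂) (outer v) →
              ∃ i, x = middle i := fun hall => by
            obtain ⟨i, hi⟩ := hall _ rfl
            exact outer_ne_middle v i hi
          rw [label3_outer]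
          simp only [G, dif_neg hc]
          have hrel : stack π₁ π₂ (outer (key _ hc).choose) (outer v) :=
            Quotient.exact (key _ hc).choose_spec
          exact (h (x := (key _ hc).choose) (y := v) hrel).symm
      refine ⟨⟨fun i => G (Quotient.mk (stack π₁ π₂) (middle i)), ?_⟩, ?_⟩
      · intro x y hxy
        change label3 b _ t x = label3 b _ t y
        rw [hG, hG, Quotient.sound hxy]
      · funext c
        change label3 b _ t c.1.out = g c
        rw [hG, Quotient.out_eq]
        simp only [G, dif_pos c.2]
  rw [Nat.card_congr (Equiv.ofBijective fwd hbij), Nat.card_fun, Nat.card_eq_fintype_card,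
    Fintype.card_fin]
  rfl

theorem concat_le_of_stack_le {n : ℕ} (π₁ π₂ : SetPartition k) (b m t : Fin k → Fin n)
    (h : stack π₁ π₂ ≤ Setoid.ker (label3 b m t)) :
    concat π₁ π₂ ≤ Setoid.ker (Sum.elim b t) := by
  intro x y hxy
  have := h hxy
  change label3 b m t (outer x) = label3 b m t (outer y) at this
  rwa [label3_outer, label3_outer] at this

open Classical in
/-- The matrix by which the diagram of `π` acts on the `k`-th tensor power of the permutation
module: the entry at row `t` (labels of the top vertices) and column `b` (labels of the bottom
vertices) is `1` if the labels agree on every block of `π`, and `0` otherwise. -/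
noncomputable def diagramMatrix (R : Type*) [CommRing R] (n : ℕ) (π : SetPartition k) :
    Matrix (Fin k → Fin n) (Fin k → Fin n) R :=
  Matrix.of fun t b => if π ≤ Setoid.ker (Sum.elim b t) then 1 else 0

theorem diagramMatrix_mul (R : Type*) [CommRing R] (n : ℕ) (π₁ π₂ : SetPartition k) :
    diagramMatrix R n π₁ * diagramMatrix R n π₂ =
      (n : R) ^ removed π₁ π₂ • diagramMatrix R n (concat π₁ π₂) := by
  classical
  ext t b
  have h1 : ∀ m : Fin k → Fin n, diagramMatrix R n π₁ t m * diagramMatrix R n π₂ m b =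
      if stack π₁ π₂ ≤ Setoid.ker (label3 b m t) then 1 else 0 := by
    intro m
    rw [stack_le_iff, label3_upper, label3_lower]
    simp only [diagramMatrix, Matrix.of_apply]
    split_ifs <;> simp_all
  rw [Matrix.mul_apply, Finset.sum_congr rfl fun m _ => h1 m, Finset.sum_boole,
    ← Fintype.card_subtype, ← Nat.card_eq_fintype_card]
  by_cases h : concat π₁ π₂ ≤ Setoid.ker (Sum.elim b t)
  · rw [card_middle π₁ π₂ b t h]
    simp [diagramMatrix, h]
  · have : IsEmpty {m : Fin k → Fin n // stack π₁ π₂ ≤ Setoid.ker (label3 b m t)} :=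
      ⟨fun m => h (concat_le_of_stack_le π₁ π₂ b m.1 t m.2)⟩
    simp [diagramMatrix, h]

theorem diagramMatrix_idPart (R : Type*) [CommRing R] (n : ℕ) :
    diagramMatrix R n (idPart k) = 1 := by
  classical
  ext t b
  have : idPart k ≤ Setoid.ker (Sum.elim b t) ↔ t = b := by
    constructor
    · intro h
      funext i
      exact (h (x := Sum.inl i) (y := Sum.inr i) rfl).symm
    · rintro rfl x y hxy
      have hx : ∀ z : Vertex k, Sum.elim t t z = t (Sum.elim id id z) := by
        intro z; cases z <;> rfl
      change Sum.elim t t x = Sum.elim t t y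
      rw [hx, hx]
      exact congrArg t hxy
  simp [diagramMatrix, this, Matrix.one_apply]

/-- Diagrams are determined, up to positive scalars, by their action for `n = 2`. -/
theorem diagramMatrix_two {c d : ℕ} {π ρ : SetPartition k}
    (h : (2 : ℤ) ^ c • diagramMatrix ℤ 2 π = (2 : ℤ) ^ d • diagramMatrix ℤ 2 ρ) :
    c = d ∧ π = ρ := by
  classical
  have h0 : ∀ t b, (2 : ℤ) ^ c * diagramMatrix ℤ 2 π t b = 2 ^ d * diagramMatrix ℤ 2 ρ t b :=
    fun t b => congrFun (congrFun h t) b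
  have hcd : c = d := by
    have hc : ∀ σ : SetPartition k, diagramMatrix ℤ 2 σ (fun _ => 0) (fun _ => 0) = 1 := by
      intro σ
      have : σ ≤ Setoid.ker (Sum.elim (fun _ => (0 : Fin 2)) fun _ => 0) := by
        intro x y _
        cases x <;> cases y <;> rfl
      simp only [diagramMatrix, Matrix.of_apply, if_pos this]
    have h2 := h0 (fun _ => 0) (fun _ => 0)
    rw [hc, hc, mul_one, mul_one] at h2
    exact Int.pow_right_injective (le_refl 2) h2
  subst hcd
  refine ⟨rfl, ?_⟩
  have h1 : ∀ f : Vertex k → Fin 2, π ≤ Setoid.ker f ↔ ρ ≤ Setoid.ker f := by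
    intro f
    have h2 := mul_left_cancel₀ (pow_ne_zero c (by norm_num : (2 : ℤ) ≠ 0))
      (h0 (f ∘ Sum.inr) (f ∘ Sum.inl))
    have hf : Sum.elim (f ∘ Sum.inl) (f ∘ Sum.inr) = f := Sum.elim_comp_inl_inr f
    simp only [diagramMatrix, Matrix.of_apply, hf] at h2
    split_ifs at h2 <;> simp_all
  have h3 : ∀ σ τ : SetPartition k,
      (∀ f : Vertex k → Fin 2, σ ≤ Setoid.ker f → τ ≤ Setoid.ker f) → τ ≤ σ := by
    intro σ τ hst x y hxy
    have := hst (fun z => if σ x z then 1 else 0) (by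
      intro u v huv
      have : σ x u ↔ σ x v := ⟨fun hu => σ.trans hu huv, fun hv => σ.trans hv (σ.symm huv)⟩
      simp [Setoid.ker_def, this]) hxy
    simp only [Setoid.ker_def, σ.refl, if_true] at this
    by_contra hn
    simp [hn] at this
  exact le_antisymm (h3 ρ π fun f => (h1 f).2) (h3 π ρ fun f => (h1 f).1)

theorem concat_assoc (π₁ π₂ π₃ : SetPartition k) :
    removed π₁ π₂ + removed (concat π₁ π₂) π₃ = removed π₂ π₃ + removed π₁ (concat π₂ π₃) ∧
      concat (concat π₁ π₂) π₃ = concat π₁ (concat π₂ π₃) := by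
  apply diagramMatrix_two
  have h := mul_assoc (diagramMatrix ℤ 2 π₁) (diagramMatrix ℤ 2 π₂) (diagramMatrix ℤ 2 π₃)
  simpa only [diagramMatrix_mul, smul_mul_assoc, mul_smul_comm, smul_smul, ← pow_add,
    Nat.cast_ofNat] using h

theorem idPart_concat (π : SetPartition k) :
    removed (idPart k) π = 0 ∧ concat (idPart k) π = π := by
  apply diagramMatrix_two
  have h := diagramMatrix_mul ℤ 2 (idPart k) π
  rw [diagramMatrix_idPart, one_mul] at h
  rw [pow_zero, one_smul]
  exact h.symm

theorem concat_idPart (π : SetPartition k) :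
    removed π (idPart k) = 0 ∧ concat π (idPart k) = π := by
  apply diagramMatrix_two
  have h := diagramMatrix_mul ℤ 2 π (idPart k)
  rw [diagramMatrix_idPart, mul_one] at h
  rw [pow_zero, one_smul]
  exact h.symm

end Combinatorics

section Ring

variable {F : Type*} [Field F] {k : ℕ} {ξ : F}

theorem mul_assoc' (a b c : PartitionAlgebra F k ξ) : a * b * c = a * (b * c) := by
  have h₁ : ∀ π₁ π₂ : SetPartition k, diagram ξ π₁ * diagram ξ π₂ * c =
      diagram ξ π₁ * (diagram ξ π₂ * c) := by
    intro π₁ π₂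
    have h : mulLin F k ξ (mulLin F k ξ (diagram ξ π₁) (diagram ξ π₂)) =
        (mulLin F k ξ (diagram ξ π₁)).comp (mulLin F k ξ (diagram ξ π₂)) := by
      refine (diagramBasis F k ξ).ext fun π₃ => ?_
      change diagram ξ π₁ * diagram ξ π₂ * diagram ξ π₃ =
        diagram ξ π₁ * (diagram ξ π₂ * diagram ξ π₃)
      have hl : ∀ (r : F) (x y : PartitionAlgebra F k ξ), r • x * y = r • (x * y) :=
        fun r x y => (mulLin F k ξ).map_smul₂ r x y
      have hr : ∀ (r : F) (x y : PartitionAlgebra F k ξ), x * r • y = r • (x * y) :=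
        fun r x y => (mulLin F k ξ x).map_smul r y
      obtain ⟨h1, h2⟩ := concat_assoc π₁ π₂ π₃
      rw [diagram_mul, diagram_mul, hl, hr, diagram_mul, diagram_mul, smul_smul, smul_smul,
        ← pow_add, ← pow_add, h1, h2]
    exact LinearMap.congr_fun h c
  have h₂ : ∀ π₁ : SetPartition k, diagram ξ π₁ * b * c = diagram ξ π₁ * (b * c) := by
    intro π₁
    have h : ((mulLin F k ξ).flip c).comp (mulLin F k ξ (diagram ξ π₁)) =
        (mulLin F k ξ (diagram ξ π₁)).comp ((mulLin F k ξ).flip c) :=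
      (diagramBasis F k ξ).ext fun π₂ => h₁ π₁ π₂
    exact LinearMap.congr_fun h b
  have h : ((mulLin F k ξ).flip c).comp ((mulLin F k ξ).flip b) =
      (mulLin F k ξ).flip (mulLin F k ξ b c) := (diagramBasis F k ξ).ext h₂
  exact LinearMap.congr_fun h a

theorem one_mul' (a : PartitionAlgebra F k ξ) : 1 * a = a := by
  have h : mulLin F k ξ (diagram ξ (idPart k)) = LinearMap.id := by
    refine (diagramBasis F k ξ).ext fun π => ?_
    change diagram ξ (idPart k) * diagram ξ π = diagram ξ π
    rw [diagram_mul, (idPart_concat π).1, (idPart_concat π).2, pow_zero, one_smul]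
  exact LinearMap.congr_fun h a

theorem mul_one' (a : PartitionAlgebra F k ξ) : a * 1 = a := by
  have h : (mulLin F k ξ).flip (diagram ξ (idPart k)) = LinearMap.id := by
    refine (diagramBasis F k ξ).ext fun π => ?_
    change diagram ξ π * diagram ξ (idPart k) = diagram ξ π
    rw [diagram_mul, (concat_idPart π).1, (concat_idPart π).2, pow_zero, one_smul]
  exact LinearMap.congr_fun h a

noncomputable instance : Ring (PartitionAlgebra F k ξ) :=
  { (inferInstance : AddCommGroup (PartitionAlgebra F k ξ)),
    (inferInstance : Mul (PartitionAlgebra F k ξ)),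
    (inferInstance : One (PartitionAlgebra F k ξ)) with
    left_distrib := fun a b c => (mulLin F k ξ a).map_add b c
    right_distrib := fun a b c => (mulLin F k ξ).map_add₂ a b c
    zero_mul := fun a => (mulLin F k ξ).map_zero₂ a
    mul_zero := fun a => (mulLin F k ξ a).map_zero
    mul_assoc := mul_assoc'
    one_mul := one_mul'
    mul_one := mul_one' }

noncomputable instance : Algebra F (PartitionAlgebra F k ξ) :=
  Algebra.ofModule (fun r x y => (mulLin F k ξ).map_smul₂ r x y)
    (fun r x y => (mulLin F k ξ x).map_smul r y)

open Classical in
/-- The orbit basis element `x_π`, defined recursively so that `d_π = ∑_{ρ ≥ π} x_ρ`. -/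
noncomputable def orbit (ξ : F) (π : SetPartition k) : PartitionAlgebra F k ξ :=
  diagram ξ π - ∑ ρ : {ρ : SetPartition k // π < ρ}, orbit ξ ρ.1
termination_by (wellFounded_gt (α := SetPartition k)).wrap π
decreasing_by exact ρ.2

open Classical in
/-- The defining relation of the orbit basis. -/
theorem diagram_eq_sum_orbit (π : SetPartition k) :
    diagram ξ π = ∑ ρ : SetPartition k with π ≤ ρ, orbit ξ ρ := by
  have h : (Finset.univ.filter fun ρ : SetPartition k => π ≤ ρ) =
      insert π (Finset.univ.filter fun ρ : SetPartition k => π < ρ) := by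
    ext ρ
    simp [le_iff_eq_or_lt, eq_comm]
  rw [h, Finset.sum_insert (by simp), orbit,
    ← Finset.sum_subtype (Finset.univ.filter fun ρ : SetPartition k => π < ρ) (by simp)
      (fun ρ => orbit ξ ρ)]
  simp

end Ring

section TensorSpace

variable (F : Type*) [Field F]

/-- The `k`-th tensor power of the permutation module `F ^ n` of the symmetric group. -/
abbrev TensorSpace (n k : ℕ) : Type _ := ⨂[F] _ : Fin k, (Fin n → F)

/-- The basis of simple tensors `u_{r 1} ⊗ ⋯ ⊗ u_{r k}`. -/
noncomputable def tensorBasis (n k : ℕ) :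
    Module.Basis (Fin k → Fin n) F (TensorSpace F n k) :=
  Basis.piTensorProduct fun _ : Fin k => Pi.basisFun F (Fin n)

/-- The linear extension of `d_π ↦ diagramMatrix π`, as an algebra homomorphism. -/
noncomputable def matrixRep (n k : ℕ) :
    PartitionAlgebra F k (n : F) →ₐ[F] Matrix (Fin k → Fin n) (Fin k → Fin n) F :=
  AlgHom.ofLinearMap
    ((diagramBasis F k (n : F)).constr F fun π => diagramMatrix F n π)
    (by
      rw [one_def, diagram, Module.Basis.constr_basis, diagramMatrix_idPart])
    (by
      intro a b
      have h : (mulLin F k (n : F)).compr₂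
            ((diagramBasis F k (n : F)).constr F fun π => diagramMatrix F n π) =
          (LinearMap.mul F (Matrix (Fin k → Fin n) (Fin k → Fin n) F)).compl₁₂
            ((diagramBasis F k (n : F)).constr F fun π => diagramMatrix F n π)
            ((diagramBasis F k (n : F)).constr F fun π => diagramMatrix F n π) := by
        refine (diagramBasis F k (n : F)).ext fun π₁ => (diagramBasis F k (n : F)).ext fun π₂ => ?_
        change (diagramBasis F k (n : F)).constr F (fun π => diagramMatrix F n π)
            (diagram (n : F) π₁ * diagram (n : F) π₂) = _
        rw [diagram_mul, map_smul, diagram, Module.Basis.constr_basis]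
        simp only [LinearMap.compl₁₂_apply, Module.Basis.constr_basis, LinearMap.mul_apply_apply,
          diagramMatrix_mul]
      exact LinearMap.congr_fun (LinearMap.congr_fun h a) b)

theorem matrixRep_diagram (n k : ℕ) (π : SetPartition k) :
    matrixRep F n k (diagram (n : F) π) = diagramMatrix F n π := by
  change (diagramBasis F k (n : F)).constr F (fun π => diagramMatrix F n π) _ = _
  rw [diagram, Module.Basis.constr_basis]

open Classical in
/-- An orbit basis element acts by the indicator of the labelings that agree exactly on the
blocks. -/
theorem matrixRep_orbit (n k : ℕ) (π : SetPartition k) (t b : Fin k → Fin n) :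
    matrixRep F n k (orbit (n : F) π) t b =
      if ∀ x y, Sum.elim b t x = Sum.elim b t y ↔ π x y then 1 else 0 := by
  have hP : ∀ ρ : SetPartition k, (∀ x y, Sum.elim b t x = Sum.elim b t y ↔ ρ x y) ↔
      ρ = Setoid.ker (Sum.elim b t) := by
    intro ρ
    constructor
    · intro h
      exact Setoid.ext fun x y => (h x y).symm
    · rintro rfl x y
      rfl
  induction π using (wellFounded_gt (α := SetPartition k)).induction with
  | _ π ih =>
    rw [orbit, map_sub, map_sum, matrixRep_diagram, Matrix.sub_apply, Matrix.sum_apply,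
      Finset.sum_congr rfl fun ρ _ => ih ρ.1 ρ.2]
    simp only [hP, diagramMatrix, Matrix.of_apply]
    by_cases h1 : π = Setoid.ker (Sum.elim b t)
    · have : ∀ ρ : {ρ : SetPartition k // π < ρ}, ρ.1 ≠ Setoid.ker (Sum.elim b t) :=
        fun ρ h => (ne_of_lt ρ.2) (h1.trans h.symm)
      simp only [this, if_false, Finset.sum_const_zero, if_pos h1, if_pos h1.le, sub_zero]
    · by_cases h2 : π ≤ Setoid.ker (Sum.elim b t)
      · have h3 : ∀ ρ : {ρ : SetPartition k // π < ρ}, ρ.1 = Setoid.ker (Sum.elim b t) ↔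
            ρ = ⟨Setoid.ker (Sum.elim b t), lt_of_le_of_ne h2 h1⟩ := fun ρ => by
          rw [Subtype.ext_iff]
        simp [h1, h2, h3]
      · have : ∀ ρ : {ρ : SetPartition k // π < ρ}, ρ.1 ≠ Setoid.ker (Sum.elim b t) :=
          fun ρ h => h2 (h ▸ ρ.2.le)
        simp [h1, h2, this]

/-- The representation `Φ_{k,n}` of `P_k(n)` on the `k`-th tensor power. -/
noncomputable def Phi (n k : ℕ) :
    PartitionAlgebra F k (n : F) →ₐ[F] Module.End F (TensorSpace F n k) :=
  ((Matrix.toLinAlgEquiv (tensorBasis F n k)).toAlgHom).comp (matrixRep F n k)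

end TensorSpace

section Half

variable {F : Type*} [Field F] {k : ℕ}

/-- The set partitions of the `2(k+1)` vertices for which the last bottom vertex and the last top
vertex are in the same block. -/
def IsHalf (π : SetPartition (k + 1)) : Prop := π (Sum.inl (Fin.last k)) (Sum.inr (Fin.last k))

theorem isHalf_concat {π₁ π₂ : SetPartition (k + 1)} (h₁ : IsHalf π₁) (h₂ : IsHalf π₂) :
    IsHalf (concat π₁ π₂) := by
  refine (stack π₁ π₂).trans (b := middle (Fin.last k)) ?_ ?_
  · exact Relation.EqvGen.rel _ _ (Or.inr ⟨_, _, h₂, rfl, rfl⟩)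
  · exact Relation.EqvGen.rel _ _ (Or.inl ⟨_, _, h₁, rfl, rfl⟩)

/-- The algebra `P_{k+1/2}(ξ)`: the span in `P_{k+1}(ξ)` of the diagrams for which the last bottom
vertex and the last top vertex are in the same block. -/
noncomputable def halfAlgebra (F : Type*) [Field F] (k : ℕ) (ξ : F) :
    Subalgebra F (PartitionAlgebra F (k + 1) ξ) :=
  (Submodule.span F (diagram ξ '' {π : SetPartition (k + 1) | IsHalf π})).toSubalgebra
    (Submodule.subset_span ⟨idPart (k + 1), rfl, rfl⟩)
    (by
      intro a b ha hb
      induction ha, hb using Submodule.span_induction₂ with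
      | mem_mem x y hx hy =>
        obtain ⟨π₁, h₁, rfl⟩ := hx
        obtain ⟨π₂, h₂, rfl⟩ := hy
        rw [diagram_mul]
        exact Submodule.smul_mem _ _ (Submodule.subset_span ⟨concat π₁ π₂, isHalf_concat h₁ h₂, rfl⟩)
      | zero_left y hy => rw [zero_mul]; exact Submodule.zero_mem _
      | zero_right x hx => rw [mul_zero]; exact Submodule.zero_mem _
      | add_left x y z _ _ _ h1 h2 => rw [add_mul]; exact Submodule.add_mem _ h1 h2
      | add_right x y z _ _ _ h1 h2 => rw [mul_add]; exact Submodule.add_mem _ h1 h2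
      | smul_left r x y _ _ h => rw [smul_mul_assoc]; exact Submodule.smul_mem _ _ h
      | smul_right r x y _ _ h => rw [mul_smul_comm]; exact Submodule.smul_mem _ _ h)

theorem orbit_mem_halfAlgebra (ξ : F) (π : SetPartition (k + 1)) (h : IsHalf π) :
    orbit ξ π ∈ halfAlgebra F k ξ := by
  induction π using (wellFounded_gt (α := SetPartition (k + 1))).induction with
  | _ π ih =>
    rw [orbit]
    refine Subalgebra.sub_mem _ (Submodule.subset_span ⟨π, h, rfl⟩)
      (Subalgebra.sum_mem _ fun ρ _ => ih ρ.1 ρ.2 (ρ.2.le h))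

theorem matrixRep_apply_eq_zero (n : ℕ) {a : PartitionAlgebra F (k + 1) (n : F)}
    (ha : a ∈ halfAlgebra F k (n : F)) (t b : Fin (k + 1) → Fin n)
    (h : b (Fin.last k) ≠ t (Fin.last k)) : matrixRep F n (k + 1) a t b = 0 := by
  change a ∈ Submodule.span F (diagram (n : F) '' {π : SetPartition (k + 1) | IsHalf π}) at ha
  induction ha using Submodule.span_induction with
  | mem x hx =>
    obtain ⟨π, hπ, rfl⟩ := hx
    rw [matrixRep_diagram]
    simp only [diagramMatrix, Matrix.of_apply]
    exact if_neg fun hle => h (hle hπ)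
  | zero => simp
  | add x y _ _ hx hy => simp [hx, hy]
  | smul r x _ hx => simp [hx]

/-- The restriction of `matrixRep` on `P_{k+1/2}(n) ⊆ P_{k+1}(n)` to the row and column labels
whose last entry is the fixed label `j`. -/
noncomputable def matrixRepHalf (F : Type*) [Field F] (n k : ℕ) (j : Fin n) :
    halfAlgebra F k (n : F) →ₐ[F] Matrix (Fin k → Fin n) (Fin k → Fin n) F :=
  AlgHom.ofLinearMap
    { toFun := fun a => (matrixRep F n (k + 1) a.1).submatrix
        (fun r => (Fin.snoc r j : Fin (k + 1) → Fin n))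
        (fun r => (Fin.snoc r j : Fin (k + 1) → Fin n))
      map_add' := fun a b => by ext; simp
      map_smul' := fun r a => by ext; simp }
    (by
      have hinj : Function.Injective fun r : Fin k → Fin n =>
          (Fin.snoc r j : Fin (k + 1) → Fin n) := fun r r' h => by
        have := congrArg Fin.init h
        simpa using this
      simp [Matrix.submatrix_one _ hinj])
    (by
      intro a b
      ext t r
      simp only [LinearMap.coe_mk, AddHom.coe_mk, MulMemClass.coe_mul, map_mul,
        Matrix.submatrix_apply, Matrix.mul_apply]
      rw [← Fintype.sum_equiv (Fin.snocEquiv fun _ : Fin (k + 1) => Fin n)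
        (fun p => matrixRep F n (k + 1) a.1 (Fin.snoc t j) (Fin.snoc p.2 p.1) *
          matrixRep F n (k + 1) b.1 (Fin.snoc p.2 p.1) (Fin.snoc r j)) _ (fun p => rfl),
        Fintype.sum_prod_type, Finset.sum_eq_single j]
      · intro l _ hl
        refine Finset.sum_eq_zero fun m _ => ?_
        rw [matrixRep_apply_eq_zero n a.2 _ _ (by simpa using hl), zero_mul]
      · simp)

/-- The representation `Φ_{k+1/2,n}` of `P_{k+1/2}(n)` on the `k`-th tensor power, identified with
the tensors `v ⊗ u_n` in the `(k+1)`-st tensor power (`n - 1 : Fin n` is the last label). -/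
noncomputable def PhiHalf (F : Type*) [Field F] (n k : ℕ) (hn : 1 ≤ n) :
    halfAlgebra F k (n : F) →ₐ[F] Module.End F (TensorSpace F n k) :=
  ((Matrix.toLinAlgEquiv (tensorBasis F n k)).toAlgHom).comp
    (matrixRepHalf F n k ⟨n - 1, Nat.sub_lt hn Nat.one_pos⟩)

end Half

section Generator

/-- The set partition of the `2k` vertices in which both vertices of each of the first `s` columns
are isolated and the two vertices of each later column form a block. -/
def rookPart (k s : ℕ) : SetPartition k where
  r x y := x = y ∨ (Sum.elim id id x = Sum.elim id id y ∧ s ≤ (Sum.elim id id x : Fin k).1)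
  iseqv :=
    { refl := fun _ => Or.inl rfl
      symm := by
        rintro x y (rfl | ⟨h, hs⟩)
        · exact Or.inl rfl
        · exact Or.inr ⟨h.symm, h ▸ hs⟩
      trans := by
        rintro x y z (rfl | ⟨h, hs⟩) (rfl | ⟨h', hs'⟩)
        · exact Or.inl rfl
        · exact Or.inr ⟨h', hs'⟩
        · exact Or.inr ⟨h, hs⟩
        · exact Or.inr ⟨h.trans h', hs⟩ }

/-- The set partition `π_{k,n}` (used for `n < 2k`): if `k ≤ n`, the first `n + 1 - k` columns
consist of isolated vertices and the last `2k - n - 1` columns are vertical edges; if `n < k`, it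
is the identity partition. -/
def genPart (n k : ℕ) : SetPartition k :=
  if k ≤ n then rookPart k (n + 1 - k) else idPart k

/-- The orbit basis element `e_{k,n}` of `P_k(n)` (used for `n < 2k`). -/
noncomputable def gen (F : Type*) [Field F] (n k : ℕ) : PartitionAlgebra F k (n : F) :=
  orbit (n : F) (genPart n k)

theorem isHalf_genPart {n k : ℕ} (h : n < 2 * k + 1) : IsHalf (genPart n (k + 1)) := by
  unfold IsHalf
  by_cases hk : k + 1 ≤ n
  · rw [genPart, if_pos hk]
    refine Or.inr ⟨rfl, ?_⟩
    simp only [Sum.elim_inl, id_eq, Fin.val_last]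
    omega
  · rw [genPart, if_neg hk]
    rfl

/-- The element `e_{k+1/2,n} = e_{k+1,n}` of `P_{k+1/2}(n)`, for `2k + 1 > n`. -/
noncomputable def genHalf (F : Type*) [Field F] (n k : ℕ) (h : n < 2 * k + 1) :
    halfAlgebra F k (n : F) :=
  ⟨gen F n (k + 1), orbit_mem_halfAlgebra (n : F) _ (isHalf_genPart h)⟩

end Generator

end PartitionAlgebra

/-!
The kernel is first computed in the orbit basis: the matrix entry of `∑ c_π x_π` at the labelings
`t`, `b` is `c_π` for the partition `π` of the vertices by labels, so an element is in the kernel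
exactly when it involves only those `x_π` for which `π` has more than `n` blocks. It remains to show
that all of these lie in the ideal generated by `x_{π_{k,n}}`. Only multiplication by very simple
diagrams is needed for this, and no product of two orbit basis elements.

* Permutations of a row permute the orbit basis.
* The diagram that joins the columns `j` and `u` fixes `x_π` if the top vertices `j` and `u` are in
  the same block, and kills it otherwise.
* The diagram that cuts the column `j` sends `x_π` to the sum of all `x_τ` such that `τ` agrees with
  `π` apart from the top vertex `j`, times the scalar `n - |π| + 1` if `j` is isolated in `π`
  (`cutPart_mul_orbit`).

Combining the last two, a top vertex can be moved to the block of another top vertex. When this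
lowers the number of blocks to `m`, it costs the scalar `n - m`, which is nonzero for `m > n` in
characteristic zero. Hence, splitting vertices off their blocks and using the same argument for the
bottom row by reflection, it is enough to treat the partitions in which distinct vertices of a row
are in distinct blocks (`IsStable.orbit_mem_of_discreteRows`). These are partial matchings of the
two rows. Those with the same number of edges as `π_{k,n}` differ from it by permutations. For those
with fewer edges, add an edge and cut it again: the resulting sum contains the wanted element, and
its other terms either have one edge more or arise by moving a vertex
(`IsStable.orbit_mem_of_rookPart`).

The half-integer case is the same argument with the last column frozen: every diagram used above
leaves this column connected. Both cases are therefore treated together, for subspaces that are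
stable under multiplication by diagrams with a set `H` of frozen columns, where `H` has at most one
element.
-/

/-! ### Isolating and attaching a point of a set partition -/

namespace Setoid

variable {V : Type*}

/-- The set partition obtained from `π` by turning the point `v` into a block of its own. -/
def isolate (v : V) (π : Setoid V) : Setoid V where
  r x y := x = y ∨ (x ≠ v ∧ y ≠ v ∧ π x y)
  iseqv :=
    { refl := fun _ => Or.inl rfl
      symm := by
        rintro x y (rfl | ⟨hx, hy, h⟩)
        · exact Or.inl rfl
        · exact Or.inr ⟨hy, hx, π.symm h⟩
      trans := by
        rintro x y z (rfl | ⟨hx, hy, h⟩) (rfl | ⟨hy', hz, h'⟩)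
        · exact Or.inl rfl
        · exact Or.inr ⟨hy', hz, h'⟩
        · exact Or.inr ⟨hx, hy, h⟩
        · exact Or.inr ⟨hx, hz, π.trans h h'⟩ }

theorem isolate_apply {v : V} {π : Setoid V} {x y : V} :
    isolate v π x y ↔ x = y ∨ (x ≠ v ∧ y ≠ v ∧ π x y) := Iff.rfl

/-- The point `v` is a block of `π` of its own. -/
def IsIsolated (v : V) (π : Setoid V) : Prop := ∀ x, π v x → x = v

theorem isolate_le (v : V) (π : Setoid V) : isolate v π ≤ π := by
  rintro x y (rfl | ⟨-, -, h⟩)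
  · exact π.refl _
  · exact h

theorem isolate_mono (v : V) {π ρ : Setoid V} (h : π ≤ ρ) : isolate v π ≤ isolate v ρ := by
  rintro x y (rfl | ⟨hx, hy, hxy⟩)
  · exact Or.inl rfl
  · exact Or.inr ⟨hx, hy, h hxy⟩

theorem isIsolated_isolate (v : V) (π : Setoid V) : IsIsolated v (isolate v π) := by
  rintro x (rfl | ⟨h, -, -⟩)
  · rfl
  · exact absurd rfl h

theorem IsIsolated.isolate_eq {v : V} {π : Setoid V} (h : IsIsolated v π) : isolate v π = π := by
  refine le_antisymm (isolate_le v π) fun {x y} hxy => ?_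
  by_cases hx : x = v
  · subst hx
    exact Or.inl (h y hxy).symm
  by_cases hy : y = v
  · subst hy
    exact Or.inl (h x (π.symm hxy))
  exact Or.inr ⟨hx, hy, hxy⟩

theorem isolate_isolate (v : V) (π : Setoid V) : isolate v (isolate v π) = isolate v π :=
  (isIsolated_isolate v π).isolate_eq

theorem not_isIsolated {v w : V} {π : Setoid V} (hw : w ≠ v) (h : π v w) : ¬ IsIsolated v π :=
  fun hv => hw (hv w h)

theorem exists_of_not_isIsolated {v : V} {π : Setoid V} (h : ¬ IsIsolated v π) :
    ∃ w, π v w ∧ w ≠ v := by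
  unfold IsIsolated at h
  push Not at h
  exact h

section Attach

variable [DecidableEq V]

/-- The set partition obtained from `π` by moving the point `v` to the block of `w`. -/
def attach (v w : V) (π : Setoid V) : Setoid V := comap (Function.update id v w) π

theorem attach_apply {v w x y : V} {π : Setoid V} : attach v w π x y ↔
    π (Function.update id v w x) (Function.update id v w y) := Iff.rfl

theorem attach_self (v : V) (π : Setoid V) : attach v v π = π := by
  have h : Function.update id v v = (id : V → V) := Function.update_eq_self v id
  ext x y
  rw [attach_apply, h, id, id]

theorem attach_apply_of_ne {v w x y : V} {π : Setoid V} (hx : x ≠ v) (hy : y ≠ v) :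
    attach v w π x y ↔ π x y := by
  simp [attach_apply, hx, hy]

theorem attach_apply_left {v w x : V} {π : Setoid V} (hx : x ≠ v) :
    attach v w π v x ↔ π w x := by
  simp [attach_apply, hx]

theorem attach_rel {v w : V} (π : Setoid V) (hw : w ≠ v) : attach v w π v w :=
  (attach_apply_left hw).2 (π.refl w)

theorem isolate_attach (v w : V) (π : Setoid V) : isolate v (attach v w π) = isolate v π := by
  ext x y
  rw [isolate_apply, isolate_apply]
  refine or_congr_right ?_
  constructor
  · rintro ⟨hx, hy, h⟩
    exact ⟨hx, hy, (attach_apply_of_ne hx hy).1 h⟩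
  · rintro ⟨hx, hy, h⟩
    exact ⟨hx, hy, (attach_apply_of_ne hx hy).2 h⟩

/-- A set partition is recovered from its restriction to the points other than `v` and from one
point `w ≠ v` of the block of `v`. -/
theorem eq_of_isolate_eq {v w : V} {π ρ : Setoid V} (hw : w ≠ v) (hπ : π v w) (hρ : ρ v w)
    (h : isolate v π = isolate v ρ) : π = ρ := by
  have key : ∀ {π ρ : Setoid V}, π v w → ρ v w → isolate v π = isolate v ρ → π ≤ ρ := by
    intro π ρ hπ hρ h
    have h0 : ∀ {x y}, x ≠ v → y ≠ v → π x y → ρ x y := fun hx hy hxy =>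
      isolate_le v ρ (h ▸ (Or.inr ⟨hx, hy, hxy⟩ : isolate v π _ _))
    intro x y hxy
    by_cases hx : x = v
    · by_cases hy : y = v
      · rw [hx, hy]
      · subst hx
        exact ρ.trans hρ (h0 hw hy (π.trans (π.symm hπ) hxy))
    · by_cases hy : y = v
      · subst hy
        exact ρ.trans (h0 hx hw (π.trans hxy hπ)) (ρ.symm hρ)
      · exact h0 hx hy hxy
  exact le_antisymm (key hπ hρ h) (key hρ hπ h.symm)

theorem eq_attach {v w : V} {π ρ : Setoid V} (hw : w ≠ v) (hρ : ρ v w)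
    (h : isolate v ρ = isolate v π) : ρ = attach v w π :=
  eq_of_isolate_eq hw hρ (attach_rel π hw) (h.trans (isolate_attach v w π).symm)

/-- The point `v` can be put back into a set partition of the other points in as many ways as there
are blocks of `σ`: into one of the old blocks, or alone. -/
theorem card_isolate_eq [Finite V] {v : V} {σ : Setoid V} (hv : IsIsolated v σ) :
    Nat.card {ρ : Setoid V // isolate v ρ = σ} = Nat.card (Quotient σ) := by
  symm
  refine Nat.card_congr (Equiv.ofBijective
    (fun q => ⟨attach v q.out σ, (isolate_attach _ _ _).trans hv.isolate_eq⟩) ⟨?_, ?_⟩)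
  · intro p q hpq
    have h : attach v p.out σ = attach v q.out σ := congrArg Subtype.val hpq
    rw [← p.out_eq, ← q.out_eq]
    by_cases hp : p.out = v
    · by_cases hq : q.out = v
      · rw [hp, hq]
      · rw [hp, attach_self] at h
        have h' := attach_rel σ hq
        rw [← h] at h'
        exact absurd (hv _ h') hq
    · by_cases hq : q.out = v
      · rw [hq, attach_self] at h
        have h' := attach_rel σ hp
        rw [h] at h'
        exact absurd (hv _ h') hp
      · have h' := attach_rel σ hp
        rw [h] at h'
        exact Quotient.sound (σ.symm ((attach_apply_left hp).1 h'))
  · rintro ⟨ρ, rfl⟩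
    by_cases hρ : IsIsolated v ρ
    · refine ⟨Quotient.mk _ v, Subtype.ext ?_⟩
      have : (Quotient.mk (isolate v ρ) v).out = v :=
        hv _ (Setoid.symm' _ (Quotient.mk_out (s := isolate v ρ) v))
      simp only [this, attach_self]
      exact hρ.isolate_eq
    · obtain ⟨w, hw, hwv⟩ := Setoid.exists_of_not_isIsolated hρ
      refine ⟨Quotient.mk _ w, Subtype.ext ?_⟩
      have h1 : isolate v ρ (Quotient.mk (isolate v ρ) w).out w :=
        Quotient.mk_out (s := isolate v ρ) w
      have h2 : (Quotient.mk (isolate v ρ) w).out ≠ v := by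
        intro h
        rw [h] at h1
        exact hwv (hv _ h1)
      exact (eq_attach h2 (ρ.trans hw (ρ.symm (isolate_le v ρ h1)))
        (isolate_isolate v ρ).symm).symm

end Attach

theorem card_quotient_isolate [Finite V] {v : V} {π : Setoid V} (hv : ¬ IsIsolated v π) :
    Nat.card (Quotient (isolate v π)) = Nat.card (Quotient π) + 1 := by
  classical
  obtain ⟨w, hw, hwv⟩ := Setoid.exists_of_not_isIsolated hv
  have hr : ∀ x, Function.update id v w x ≠ v ∧ π x (Function.update id v w x) := by
    intro x
    by_cases hx : x = v
    · subst hx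
      simp [hwv, hw]
    · simp [hx]
  let g : Quotient π → Quotient (isolate v π) := Quotient.lift
    (fun x => Quotient.mk (isolate v π) (Function.update id v w x)) fun x y hxy =>
      Quotient.sound (Or.inr ⟨(hr x).1, (hr y).1,
        π.trans (π.trans (π.symm (hr x).2) hxy) (hr y).2⟩)
  have hg : ∀ q, g q ≠ Quotient.mk (isolate v π) v := by
    intro q
    induction q using Quotient.inductionOn with
    | _ x =>
      intro h
      exact (hr x).1 (isIsolated_isolate v π _ ((isolate v π).symm (Quotient.exact h)))
  have hbij : Function.Bijective (fun o : Option (Quotient π) =>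
      o.elim (Quotient.mk (isolate v π) v) g) := by
    constructor
    · rintro (_ | p) (_ | q) h
      · rfl
      · exact absurd h.symm (hg q)
      · exact absurd h (hg p)
      · induction p using Quotient.inductionOn with
        | _ x =>
          induction q using Quotient.inductionOn with
          | _ y =>
            have h' := isolate_le v π (Quotient.exact h)
            exact congrArg some (Quotient.sound
              (π.trans (π.trans (hr x).2 h') (π.symm (hr y).2)))
    · intro q
      induction q using Quotient.inductionOn with
      | _ x =>
        by_cases hx : x = v
        · subst hx
          exact ⟨none, rfl⟩
        · refine ⟨some (Quotient.mk π x), ?_⟩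
          change Quotient.mk (isolate v π) (Function.update id v w x) = _
          rw [Function.update_of_ne hx, id]
  rw [← Nat.card_congr (Equiv.ofBijective _ hbij), Finite.card_option]

end Setoid

namespace PartitionAlgebra

open Setoid (isolate attach IsIsolated)

/-! ### Products of diagrams -/

section Products

variable {k : ℕ}

theorem removed_concat_of_diagramMatrix {c : ℕ} {π₁ π₂ ρ : SetPartition k}
    (h : diagramMatrix ℤ 2 π₁ * diagramMatrix ℤ 2 π₂ = (2 : ℤ) ^ c • diagramMatrix ℤ 2 ρ) :
    removed π₁ π₂ = c ∧ concat π₁ π₂ = ρ := by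
  apply diagramMatrix_two
  rw [← h, diagramMatrix_mul, Nat.cast_ofNat]

/-- The set partition reflected in the horizontal axis. -/
def flip (π : SetPartition k) : SetPartition k := Setoid.comap Sum.swap π

theorem flip_apply {π : SetPartition k} {x y : Vertex k} :
    flip π x y ↔ π x.swap y.swap := Iff.rfl

theorem flip_flip (π : SetPartition k) : flip (flip π) = π := by
  ext x y
  simp [flip_apply]

theorem flip_le_flip {π ρ : SetPartition k} (h : π ≤ ρ) : flip π ≤ flip ρ :=
  fun {_ _} hxy => h hxy

theorem flip_le_iff {π ρ : SetPartition k} : flip π ≤ ρ ↔ π ≤ flip ρ :=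
  ⟨fun h => by simpa [flip_flip] using flip_le_flip h,
    fun h => by simpa [flip_flip] using flip_le_flip h⟩

theorem card_quotient_flip (π : SetPartition k) :
    Nat.card (Quotient (flip π)) = Nat.card (Quotient π) :=
  Nat.card_congr (Quotient.congr (Equiv.sumComm _ _) fun _ _ => Iff.rfl)

theorem diagramMatrix_flip (R : Type*) [CommRing R] (n : ℕ) (π : SetPartition k) :
    diagramMatrix R n (flip π) = (diagramMatrix R n π).transpose := by
  classical
  ext t b
  have : flip (Setoid.ker (Sum.elim b t)) = Setoid.ker (Sum.elim t b) := by
    ext x y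
    rcases x with x | x <;> rcases y with y | y <;> rfl
  simp only [diagramMatrix, Matrix.of_apply, Matrix.transpose_apply, flip_le_iff, this]

theorem removed_concat_flip (π₁ π₂ : SetPartition k) :
    removed (flip π₂) (flip π₁) = removed π₁ π₂ ∧
      concat (flip π₂) (flip π₁) = flip (concat π₁ π₂) := by
  apply removed_concat_of_diagramMatrix
  rw [diagramMatrix_flip, diagramMatrix_flip, ← Matrix.transpose_mul, diagramMatrix_mul,
    Matrix.transpose_smul, diagramMatrix_flip, Nat.cast_ofNat]

/-- The diagram of a permutation of the columns. -/
def permPart (σ : Equiv.Perm (Fin k)) : SetPartition k := Setoid.ker (Sum.elim id σ)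

theorem permPart_le_ker {α : Type*} {σ : Equiv.Perm (Fin k)} {m t : Fin k → α} :
    permPart σ ≤ Setoid.ker (Sum.elim m t) ↔ m = t ∘ σ.symm := by
  constructor
  · intro h
    funext i
    exact h (x := Sum.inl i) (y := Sum.inr (σ.symm i)) (σ.apply_symm_apply i).symm
  · rintro rfl x y hxy
    have hx : ∀ z : Vertex k, Sum.elim (t ∘ σ.symm) t z = (t ∘ σ.symm) (Sum.elim id σ z) := by
      intro z; cases z <;> simp
    change Sum.elim _ _ x = Sum.elim _ _ y
    rw [hx, hx]
    exact congrArg _ hxy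

theorem permPart_concat (σ : Equiv.Perm (Fin k)) (π : SetPartition k) :
    removed (permPart σ) π = 0 ∧
      concat (permPart σ) π = Setoid.comap (Sum.map id σ) π := by
  classical
  apply removed_concat_of_diagramMatrix
  rw [pow_zero, one_smul]
  ext t b
  have h : π ≤ Setoid.ker (Sum.elim b (t ∘ σ.symm)) ↔
      Setoid.comap (Sum.map id σ) π ≤ Setoid.ker (Sum.elim b t) := by
    have h1 : ∀ z, Sum.elim b t z = Sum.elim b (t ∘ σ.symm) (Sum.map id σ z) := by
      intro z; cases z <;> simp
    have h2 : ∀ z, Sum.elim b (t ∘ σ.symm) z = Sum.elim b t (Sum.map id σ.symm z) := by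
      intro z; cases z <;> simp
    constructor
    · intro h x y hxy
      rw [Setoid.ker_def, h1, h1]
      exact h hxy
    · intro h x y hxy
      rw [Setoid.ker_def, h2, h2]
      refine h ?_
      rw [Setoid.comap_rel]
      simpa using hxy
  simp only [Matrix.mul_apply, diagramMatrix, Matrix.of_apply, permPart_le_ker, ite_mul, one_mul,
    zero_mul, Finset.sum_ite_eq', Finset.mem_univ, if_true, h]

/-- The diagram whose blocks are the columns, except that the columns `j` and `u` form a single
block. -/
def joinPart (j u : Fin k) : SetPartition k :=
  Setoid.ker (Sum.elim (Function.update id j u) (Function.update id j u))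

theorem joinPart_le_ker {α : Type*} {j u : Fin k} {m t : Fin k → α} :
    joinPart j u ≤ Setoid.ker (Sum.elim m t) ↔ m = t ∧ t j = t u := by
  constructor
  · intro h
    refine ⟨funext fun i => h (x := Sum.inl i) (y := Sum.inr i) rfl,
      h (x := Sum.inr j) (y := Sum.inr u) ?_⟩
    change Function.update id j u j = Function.update id j u u
    by_cases hu : u = j <;> simp [Function.update_apply]
  · rintro ⟨rfl, h⟩ x y hxy
    have hx : ∀ z : Vertex k, Sum.elim m m z =
        m (Sum.elim (Function.update id j u) (Function.update id j u) z) := by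
      intro z
      rcases z with z | z <;>
      · by_cases hz : z = j
        · subst hz
          simp [h]
        · simp [hz]
    change Sum.elim _ _ x = Sum.elim _ _ y
    rw [hx, hx]
    exact congrArg _ hxy

theorem joinPart_concat (j u : Fin k) (π : SetPartition k) :
    removed (joinPart j u) π = 0 ∧ concat (joinPart j u) π =
      π ⊔ Setoid.ker (Function.update id (Sum.inr j) (Sum.inr u)) := by
  classical
  apply removed_concat_of_diagramMatrix
  rw [pow_zero, one_smul]
  ext t b
  have h : Setoid.ker (Function.update id (Sum.inr j) (Sum.inr u) : Vertex k → Vertex k) ≤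
      Setoid.ker (Sum.elim b t) ↔ t j = t u := by
    constructor
    · intro h
      refine h (x := Sum.inr j) (y := Sum.inr u) ?_
      by_cases hu : u = j <;> simp [Setoid.ker_def, Function.update_apply]
    · intro h x y hxy
      have hx : ∀ z : Vertex k, Sum.elim b t z =
          Sum.elim b t (Function.update id (Sum.inr j) (Sum.inr u) z) := by
        intro z
        by_cases hz : z = Sum.inr j
        · subst hz
          simp [h]
        · simp [hz]
      rw [Setoid.ker_def, hx, hx y]
      exact congrArg _ hxy
  simp only [Matrix.mul_apply, diagramMatrix, Matrix.of_apply, joinPart_le_ker, sup_le_iff, h]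
  rw [Finset.sum_eq_single t]
  · by_cases h1 : t j = t u <;> by_cases h2 : π ≤ Setoid.ker (Sum.elim b t) <;> simp [h1, h2]
  · intro m _ hm
    simp [hm]
  · simp

theorem sup_ker_update_le_iff {V : Type*} [DecidableEq V] {v w : V} {π ρ : Setoid V} :
    π ⊔ Setoid.ker (Function.update id v w) ≤ ρ ↔ π ≤ ρ ∧ ρ v w := by
  rw [sup_le_iff]
  refine and_congr_right fun _ => ⟨fun h => h ?_, fun h x y hxy => ?_⟩
  · by_cases hu : w = v <;> simp [Setoid.ker_def, Function.update_apply]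
  · have hx : ∀ z, ρ z (Function.update id v w z) := by
      intro z
      by_cases hz : z = v
      · subst hz
        simpa using h
      · simp [hz]
    have h1 : Function.update id v w x = Function.update id v w y := hxy
    exact ρ.trans (hx x) (h1 ▸ ρ.symm (hx y))

/-- The diagram whose blocks are the columns, except that the two vertices of the column `j` are
isolated. -/
def cutPart (j : Fin k) : SetPartition k := isolate (Sum.inr j) (idPart k)

theorem cutPart_le_ker {α : Type*} {j : Fin k} {m t : Fin k → α} :
    cutPart j ≤ Setoid.ker (Sum.elim m t) ↔ ∀ i, i ≠ j → m i = t i := by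
  constructor
  · intro h i hi
    exact h (x := Sum.inl i) (y := Sum.inr i)
      (Or.inr ⟨Sum.inl_ne_inr, fun h => hi (Sum.inr_injective h), rfl⟩)
  · rintro h x y (rfl | ⟨hx, hy, hxy⟩)
    · rfl
    · change Sum.elim id id x = Sum.elim id id y at hxy
      rcases x with x | x <;> rcases y with y | y <;>
        simp only [Sum.elim_inl, Sum.elim_inr, id] at hxy <;> subst hxy
      · rfl
      · exact h x fun e => hy (congrArg _ e)
      · exact (h x fun e => hx (congrArg _ e)).symm
      · rfl

theorem le_ker_update {V α : Type*} [DecidableEq V] {v : V} {π : Setoid V} {f : V → α} {c : α} :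
    π ≤ Setoid.ker (Function.update f v c) ↔
      isolate v π ≤ Setoid.ker f ∧ ∀ x, π v x → x ≠ v → f x = c := by
  constructor
  · intro h
    refine ⟨?_, fun x hx hxv => ?_⟩
    · rintro x y (rfl | ⟨hx, hy, hxy⟩)
      · rfl
      · simpa [Setoid.ker_def, hx, hy] using h hxy
    · simpa [Setoid.ker_def, hxv, eq_comm] using h hx
  · rintro ⟨h1, h2⟩ x y hxy
    rw [Setoid.ker_def]
    by_cases hx : x = v
    · by_cases hy : y = v
      · rw [hx, hy]
      · subst hx
        simpa [hy] using (h2 y hxy hy).symm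
    · by_cases hy : y = v
      · subst hy
        simpa [hx] using h2 x (π.symm hxy) hx
      · simpa [hx, hy] using h1 (Or.inr ⟨hx, hy, hxy⟩)

open Classical in
theorem cutPart_concat (j : Fin k) (π : SetPartition k) :
    removed (cutPart j) π = (if IsIsolated (Sum.inr j) π then 1 else 0) ∧
      concat (cutPart j) π = isolate (Sum.inr j) π := by
  apply removed_concat_of_diagramMatrix
  ext t b
  have h1 : ∀ g : (Fin k → Fin 2) → ℤ,
      ∑ m, (if ∀ i, i ≠ j → m i = t i then 1 else 0) * g m =
        ∑ c, g (Function.update t j c) := by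
    intro g
    have hinj : Function.Injective fun c : Fin 2 => Function.update t j c :=
      Function.update_injective t j
    simp only [ite_mul, one_mul, zero_mul]
    rw [← Finset.sum_filter, ← Finset.sum_image (f := g) (hinj.injOn)]
    refine Finset.sum_congr ?_ fun _ _ => rfl
    ext m
    simp only [Finset.mem_filter, Finset.mem_univ, true_and, Finset.mem_image]
    constructor
    · intro h
      refine ⟨m j, funext fun i => ?_⟩
      by_cases hi : i = j
      · subst hi
        simp
      · simp [hi, h i hi]
    · rintro ⟨c, rfl⟩ i hi
      simp [hi]
  simp only [Matrix.mul_apply, diagramMatrix, Matrix.of_apply, cutPart_le_ker, Matrix.smul_apply,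
    smul_eq_mul]
  rw [h1]
  simp only [← Sum.update_elim_inr, le_ker_update]
  by_cases h2 : isolate (Sum.inr j) π ≤ Setoid.ker (Sum.elim b t)
  · by_cases h3 : IsIsolated (Sum.inr j) π
    · have h4 : ∀ (c : Fin 2) x, π (Sum.inr j) x → x ≠ Sum.inr j → Sum.elim b t x = c :=
        fun c x hx hne => absurd (h3 x hx) hne
      simp only [h2, h3, true_and, if_true]
      rw [Finset.sum_congr rfl fun c _ => if_pos (h4 c)]
      simp
    · obtain ⟨w, hw, hwv⟩ := Setoid.exists_of_not_isIsolated h3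
      have h4 : ∀ c : Fin 2, (∀ x, π (Sum.inr j) x → x ≠ Sum.inr j → Sum.elim b t x = c) ↔
          Sum.elim b t w = c := by
        refine fun c => ⟨fun h => h w hw hwv, ?_⟩
        rintro rfl x hx hxv
        exact h2 (Or.inr ⟨hxv, hwv, π.trans (π.symm hx) hw⟩)
      simp only [h2, h3, h4, true_and, if_true, if_false, pow_zero, mul_one]
      simp
  · simp [h2]

end Products

/-! ### The action of some diagrams on the orbit basis -/

section Action

variable {F : Type*} [Field F] {k : ℕ} {ξ : F}

open Classical in
/-- By Möbius inversion, a linear map is known on the orbit basis once its values on the diagram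
basis are written as sums over coarsenings. -/
theorem map_orbit {M : Type*} [AddCommGroup M] [Module F M]
    (L : PartitionAlgebra F k ξ →ₗ[F] M) (y : SetPartition k → M)
    (h : ∀ π, L (diagram ξ π) = ∑ ρ : SetPartition k with π ≤ ρ, y ρ) (π : SetPartition k) :
    L (orbit ξ π) = y π := by
  induction π using (wellFounded_gt (α := SetPartition k)).induction with
  | _ π ih =>
    have h1 : (Finset.univ.filter fun ρ : SetPartition k => π ≤ ρ) =
        insert π (Finset.univ.filter fun ρ : SetPartition k => π < ρ) := by
      ext ρ
      simp [le_iff_eq_or_lt, eq_comm]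
    rw [orbit, map_sub, map_sum, h, h1, Finset.sum_insert (by simp),
      Finset.sum_congr rfl fun (ρ : {ρ : SetPartition k // π < ρ}) _ => ih ρ.1 ρ.2,
      ← Finset.sum_subtype (Finset.univ.filter fun ρ : SetPartition k => π < ρ) (by simp)
        (fun ρ => y ρ), add_sub_cancel_right]

/-- Reflection of diagrams in the horizontal axis, an anti-automorphism of the partition
algebra. -/
noncomputable def flipLin (F : Type*) [Field F] (k : ℕ) (ξ : F) :
    PartitionAlgebra F k ξ →ₗ[F] PartitionAlgebra F k ξ :=
  (diagramBasis F k ξ).constr F fun π => diagram ξ (flip π)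

theorem flipLin_diagram (π : SetPartition k) :
    flipLin F k ξ (diagram ξ π) = diagram ξ (flip π) := by
  rw [flipLin, diagram, Module.Basis.constr_basis]

theorem flipLin_flipLin (a : PartitionAlgebra F k ξ) : flipLin F k ξ (flipLin F k ξ a) = a := by
  have h : (flipLin F k ξ).comp (flipLin F k ξ) = LinearMap.id := by
    refine (diagramBasis F k ξ).ext fun π => ?_
    change flipLin F k ξ (flipLin F k ξ (diagram ξ π)) = diagram ξ π
    rw [flipLin_diagram, flipLin_diagram, flip_flip]
  exact LinearMap.congr_fun h a

theorem flipLin_diagram_mul (δ : SetPartition k) (a : PartitionAlgebra F k ξ) :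
    flipLin F k ξ (diagram ξ δ * a) = flipLin F k ξ a * diagram ξ (flip δ) := by
  have h : (flipLin F k ξ).comp (LinearMap.mulLeft F (diagram ξ δ)) =
      (LinearMap.mulRight F (diagram ξ (flip δ))).comp (flipLin F k ξ) := by
    refine (diagramBasis F k ξ).ext fun π => ?_
    change flipLin F k ξ (diagram ξ δ * diagram ξ π) =
      flipLin F k ξ (diagram ξ π) * diagram ξ (flip δ)
    rw [diagram_mul, map_smul, flipLin_diagram, flipLin_diagram, diagram_mul,
      (removed_concat_flip δ π).1, (removed_concat_flip δ π).2]
  exact LinearMap.congr_fun h a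

theorem flipLin_mul_diagram (δ : SetPartition k) (a : PartitionAlgebra F k ξ) :
    flipLin F k ξ (a * diagram ξ δ) = diagram ξ (flip δ) * flipLin F k ξ a := by
  rw [← flipLin_flipLin (diagram ξ (flip δ) * _), flipLin_diagram_mul, flipLin_flipLin, flip_flip]

theorem flipLin_orbit (π : SetPartition k) :
    flipLin F k ξ (orbit ξ π) = orbit ξ (flip π) := by
  classical
  refine map_orbit (flipLin F k ξ) (fun ρ => orbit ξ (flip ρ)) (fun ρ => ?_) π
  rw [flipLin_diagram, diagram_eq_sum_orbit]
  refine Finset.sum_nbij' flip flip ?_ ?_ ?_ ?_ ?_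
  · simp only [Finset.mem_filter, Finset.mem_univ, true_and]
    exact fun τ h => flip_le_iff.1 h
  · simp only [Finset.mem_filter, Finset.mem_univ, true_and]
    exact fun τ h => flip_le_flip h
  · exact fun τ _ => flip_flip τ
  · exact fun τ _ => flip_flip τ
  · exact fun τ _ => by rw [flip_flip]

theorem permPart_mul_orbit (σ : Equiv.Perm (Fin k)) (π : SetPartition k) :
    diagram ξ (permPart σ) * orbit ξ π = orbit ξ (Setoid.comap (Sum.map id σ) π) := by
  classical
  refine map_orbit (LinearMap.mulLeft F (diagram ξ (permPart σ)))
    (fun ρ => orbit ξ (Setoid.comap (Sum.map id σ) ρ)) (fun ρ => ?_) π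
  have hi : ∀ (σ : Equiv.Perm (Fin k)) (τ : SetPartition k),
      Setoid.comap (Sum.map id σ.symm) (Setoid.comap (Sum.map id σ) τ) = τ := by
    intro σ τ
    ext x y
    simp [Setoid.comap_rel]
  have hm : ∀ (σ : Equiv.Perm (Fin k)) {τ τ' : SetPartition k}, τ ≤ τ' →
      Setoid.comap (Sum.map id σ) τ ≤ Setoid.comap (Sum.map id σ) τ' :=
    fun σ τ τ' h x y hxy => h hxy
  rw [LinearMap.mulLeft_apply, diagram_mul, (permPart_concat σ ρ).1, (permPart_concat σ ρ).2,
    pow_zero, one_smul, diagram_eq_sum_orbit]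
  have hi' : ∀ τ : SetPartition k,
      Setoid.comap (Sum.map id σ) (Setoid.comap (Sum.map id σ.symm) τ) = τ := hi σ.symm
  refine Finset.sum_nbij' (Setoid.comap (Sum.map id σ.symm)) (Setoid.comap (Sum.map id σ))
    ?_ ?_ ?_ ?_ ?_
  · simp only [Finset.mem_filter, Finset.mem_univ, true_and]
    exact fun τ h => hi σ ρ ▸ hm σ.symm h
  · simp only [Finset.mem_filter, Finset.mem_univ, true_and]
    exact fun τ h => hm σ h
  · exact fun τ _ => hi' τ
  · exact fun τ _ => hi σ τ
  · exact fun τ _ => by rw [hi']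

open Classical in
theorem joinPart_mul_orbit (j u : Fin k) (π : SetPartition k) :
    diagram ξ (joinPart j u) * orbit ξ π =
      if π (Sum.inr j) (Sum.inr u) then orbit ξ π else 0 := by
  refine map_orbit (LinearMap.mulLeft F (diagram ξ (joinPart j u)))
    (fun ρ => if ρ (Sum.inr j) (Sum.inr u) then orbit ξ ρ else 0) (fun ρ => ?_) π
  rw [LinearMap.mulLeft_apply, diagram_mul, (joinPart_concat j u ρ).1, (joinPart_concat j u ρ).2,
    pow_zero, one_smul, diagram_eq_sum_orbit, ← Finset.sum_filter, Finset.filter_filter]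
  simp only [sup_ker_update_le_iff]

open Classical in
/-- Restricting the points of `π` to those other than `v` is the same as isolating `v`; among the
ways to put `v` back, it is alone exactly once, so that the given weight has total sum `ξ`. -/
theorem sum_isolate_eq {V : Type*} [Finite V] [Fintype (Setoid V)] (ξ : F) {v : V} {σ : Setoid V}
    (hv : IsIsolated v σ) :
    ∑ ρ : Setoid V with isolate v ρ = σ,
      (if IsIsolated v ρ then ξ - Nat.card (Quotient ρ) + 1 else 1) = ξ := by
  have hmem : σ ∈ Finset.univ.filter fun ρ : Setoid V => isolate v ρ = σ := by
    simpa using hv.isolate_eq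
  rw [← Finset.add_sum_erase _ _ hmem, if_pos hv,
    Finset.sum_congr rfl (g := fun _ => (1 : F)), Finset.sum_const, Finset.card_erase_of_mem hmem,
    ← Fintype.card_subtype, ← Nat.card_eq_fintype_card, Setoid.card_isolate_eq hv, nsmul_one,
    Nat.cast_pred]
  · ring
  · have : Nonempty (Quotient σ) := ⟨Quotient.mk _ v⟩
    exact Nat.card_pos
  · intro ρ hρ
    simp only [Finset.mem_erase, Finset.mem_filter, Finset.mem_univ, true_and] at hρ
    rw [if_neg]
    intro h
    exact hρ.1 (h.isolate_eq.symm.trans hρ.2)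

open Classical in
/-- Cutting the top vertex `j` off an orbit basis element puts this vertex back in all possible
ways. The scalar counts the labels that are available for the vertex if it was isolated. -/
theorem cutPart_mul_orbit (j : Fin k) (π : SetPartition k) :
    diagram ξ (cutPart j) * orbit ξ π =
      (if IsIsolated (Sum.inr j) π then ξ - Nat.card (Quotient π) + 1 else 1) •
        ∑ τ : SetPartition k with isolate (Sum.inr j) τ = isolate (Sum.inr j) π, orbit ξ τ := by
  refine map_orbit (LinearMap.mulLeft F (diagram ξ (cutPart j)))
    (fun ρ => (if IsIsolated (Sum.inr j) ρ then ξ - Nat.card (Quotient ρ) + 1 else 1) •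
        ∑ τ : SetPartition k with isolate (Sum.inr j) τ = isolate (Sum.inr j) ρ, orbit ξ τ)
    (fun π => ?_) π
  rw [LinearMap.mulLeft_apply, diagram_mul, (cutPart_concat j π).1, (cutPart_concat j π).2,
    diagram_eq_sum_orbit, Finset.smul_sum]
  simp only [Finset.smul_sum]
  rw [Finset.sum_comm' (t' := Finset.univ) (s' := fun τ => Finset.univ.filter fun ρ =>
    π ≤ ρ ∧ isolate (Sum.inr j) ρ = isolate (Sum.inr j) τ) (by simp [eq_comm]), Finset.sum_filter]
  refine Finset.sum_congr rfl fun τ _ => ?_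
  rw [← Finset.sum_smul]
  by_cases h : isolate (Sum.inr j) π ≤ τ
  · rw [if_pos h]
    congr 1
    have h' : isolate (Sum.inr j) π ≤ isolate (Sum.inr j) τ := by
      rw [← Setoid.isolate_isolate]
      exact Setoid.isolate_mono _ h
    by_cases hπ : IsIsolated (Sum.inr j) π
    · rw [if_pos hπ, pow_one]
      refine (sum_isolate_eq ξ (Setoid.isIsolated_isolate (Sum.inr j) τ)).symm.trans ?_
      refine Finset.sum_congr (Finset.filter_congr fun ρ _ => ?_) fun _ _ => rfl
      refine ⟨fun e => ⟨?_, e⟩, fun e => e.2⟩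
      rw [← hπ.isolate_eq]
      exact h'.trans (e ▸ Setoid.isolate_le _ ρ)
    · obtain ⟨w, hw, hwv⟩ := Setoid.exists_of_not_isIsolated hπ
      have h0 : (Finset.univ.filter fun ρ : SetPartition k =>
          π ≤ ρ ∧ isolate (Sum.inr j) ρ = isolate (Sum.inr j) τ) =
          {attach (Sum.inr j) w τ} := by
        ext ρ
        simp only [Finset.mem_filter, Finset.mem_univ, true_and, Finset.mem_singleton]
        constructor
        · rintro ⟨h1, h2⟩
          exact Setoid.eq_attach hwv (h1 hw) h2
        · rintro rfl
          have h1 : isolate (Sum.inr j) π ≤ attach (Sum.inr j) w τ :=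
            h'.trans ((Setoid.isolate_attach _ w τ).symm.le.trans (Setoid.isolate_le _ _))
          refine ⟨fun {x y} hxy => ?_, Setoid.isolate_attach _ w τ⟩
          -- Every point is related, for both partitions, to a point other than `v`.
          have h2 : ∀ z, ∃ z', z' ≠ Sum.inr j ∧ π z z' ∧ attach (Sum.inr j) w τ z z' := by
            intro z
            by_cases hz : z = Sum.inr j
            · exact ⟨w, hwv, hz.symm ▸ hw, hz.symm ▸ Setoid.attach_rel τ hwv⟩
            · exact ⟨z, hz, π.refl z, Setoid.refl' _ z⟩
          obtain ⟨x', hx', hxx, hx⟩ := h2 x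
          obtain ⟨y', hy', hyy, hy⟩ := h2 y
          exact Setoid.trans' _ (Setoid.trans' _ hx
            (h1 (Or.inr ⟨hx', hy', π.trans (π.trans (π.symm hxx) hxy) hyy⟩)))
            (Setoid.symm' _ hy)
      rw [h0, Finset.sum_singleton, if_neg hπ, pow_zero, if_neg]
      exact Setoid.not_isIsolated hwv (Setoid.attach_rel τ hwv)
  · rw [if_neg h]
    rw [Finset.sum_eq_zero, zero_smul]
    intro ρ hρ
    simp only [Finset.mem_filter, Finset.mem_univ, true_and] at hρ
    exact absurd ((Setoid.isolate_mono _ hρ.1).trans (hρ.2.le.trans (Setoid.isolate_le _ _))) h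

open Classical in
/-- Moving the top vertex `j` of an orbit basis element to the block of the top vertex `u`. -/
theorem joinPart_mul_cutPart_mul_orbit {j u : Fin k} (hu : u ≠ j) (π : SetPartition k) :
    diagram ξ (joinPart j u) * (diagram ξ (cutPart j) * orbit ξ π) =
      (if IsIsolated (Sum.inr j) π then ξ - Nat.card (Quotient π) + 1 else 1) •
        orbit ξ (attach (Sum.inr j) (Sum.inr u) π) := by
  have hu' : (Sum.inr u : Vertex k) ≠ Sum.inr j := fun h => hu (Sum.inr_injective h)
  rw [cutPart_mul_orbit, mul_smul_comm, Finset.mul_sum]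
  congr 1
  simp only [joinPart_mul_orbit]
  rw [← Finset.sum_filter, Finset.filter_filter]
  convert Finset.sum_singleton _ _ using 2
  ext τ
  simp only [Finset.mem_filter, Finset.mem_univ, true_and, Finset.mem_singleton]
  constructor
  · rintro ⟨h1, h2⟩
    exact Setoid.eq_attach hu' h2 h1
  · rintro rfl
    exact ⟨Setoid.isolate_attach _ _ π, Setoid.attach_rel π hu'⟩

end Action

/-! ### Set partitions with frozen columns and with discrete rows -/

section Frozen

variable {k : ℕ}

/-- The two vertices of each column in `H` are in the same block. For `H = ∅` this is no condition;
for `H` consisting of the last column it singles out the partitions of the half-integer algebra. -/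
def Frozen (H : Set (Fin k)) (π : SetPartition k) : Prop := ∀ i ∈ H, π (Sum.inl i) (Sum.inr i)

theorem Frozen.mono {H : Set (Fin k)} {π ρ : SetPartition k} (h : Frozen H π) (hle : π ≤ ρ) :
    Frozen H ρ := fun i hi => hle (h i hi)

theorem Frozen.flip {H : Set (Fin k)} {π : SetPartition k} (h : Frozen H π) :
    Frozen H (flip π) := fun i hi => π.symm (h i hi)

theorem frozen_joinPart (H : Set (Fin k)) (j u : Fin k) : Frozen H (joinPart j u) :=
  fun _ _ => rfl

theorem frozen_permPart {H : Set (Fin k)} {σ : Equiv.Perm (Fin k)} (hσ : ∀ i ∈ H, σ i = i) :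
    Frozen H (permPart σ) := fun i hi => (hσ i hi).symm

theorem Frozen.isolate {H : Set (Fin k)} {π : SetPartition k} (h : Frozen H π) {j : Fin k}
    (hj : j ∉ H) : Frozen H (isolate (Sum.inr j) π) := fun i hi =>
  Or.inr ⟨Sum.inl_ne_inr, fun e => hj (Sum.inr_injective e ▸ hi), h i hi⟩

theorem frozen_cutPart {H : Set (Fin k)} {j : Fin k} (hj : j ∉ H) : Frozen H (cutPart j) :=
  Frozen.isolate (fun _ _ => rfl) hj

theorem Frozen.notMem_of_isIsolated {H : Set (Fin k)} {π : SetPartition k} (h : Frozen H π)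
    {j : Fin k} (hj : IsIsolated (Sum.inr j) π) : j ∉ H :=
  fun hjH => Sum.inl_ne_inr (hj _ (π.symm (h j hjH)))

/-- Distinct vertices of the same row are in distinct blocks, i.e. the blocks that are not single
vertices form a partial matching of the bottom row with the top row. -/
structure DiscreteRows (π : SetPartition k) : Prop where
  bottom : ∀ {i j}, π (Sum.inl i) (Sum.inl j) → i = j
  top : ∀ {i j}, π (Sum.inr i) (Sum.inr j) → i = j

theorem DiscreteRows.flip {π : SetPartition k} (h : DiscreteRows π) : DiscreteRows (flip π) :=
  ⟨h.top, h.bottom⟩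

open Classical in
/-- The bottom vertices whose block meets the top row. -/
noncomputable def linked (π : SetPartition k) : Finset (Fin k) :=
  {i | ∃ j, π (Sum.inl i) (Sum.inr j)}

theorem mem_linked {π : SetPartition k} {i : Fin k} :
    i ∈ linked π ↔ ∃ j, π (Sum.inl i) (Sum.inr j) := by
  simp [linked]

theorem DiscreteRows.card_quotient_add {π : SetPartition k} (h : DiscreteRows π) :
    Nat.card (Quotient π) + (linked π).card = 2 * k := by
  have hbij : Function.Bijective
      (fun x : {i // i ∉ linked π} ⊕ Fin k => Quotient.mk π (x.map Subtype.val id)) := by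
    constructor
    · rintro (⟨i, hi⟩ | i) (⟨j, hj⟩ | j) hij <;> have hij' := Quotient.exact hij
      · obtain rfl := h.bottom hij'
        rfl
      · exact absurd (mem_linked.2 ⟨j, hij'⟩) hi
      · exact absurd (mem_linked.2 ⟨i, π.symm hij'⟩) hj
      · obtain rfl := h.top hij'
        rfl
    · intro q
      induction q using Quotient.inductionOn with
      | _ x =>
        rcases x with i | j
        · by_cases hi : i ∈ linked π
          · obtain ⟨j, hj⟩ := mem_linked.1 hi
            exact ⟨Sum.inr j, Quotient.sound (π.symm hj)⟩
          · exact ⟨Sum.inl ⟨i, hi⟩, rfl⟩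
        · exact ⟨Sum.inr j, rfl⟩
  have h1 : (linked π).card ≤ k := by simpa using (linked π).card_le_univ
  rw [← Nat.card_congr (Equiv.ofBijective _ hbij), Nat.card_eq_fintype_card, Fintype.card_sum,
    Fintype.card_subtype_compl, Fintype.card_fin, Fintype.card_coe]
  omega

theorem DiscreteRows.card_linked_flip {π : SetPartition k} (h : DiscreteRows π) :
    (linked (PartitionAlgebra.flip π)).card = (linked π).card := by
  have h1 := h.card_quotient_add
  have h2 := h.flip.card_quotient_add
  rw [card_quotient_flip] at h2
  omega

theorem discreteRows_rookPart (k s : ℕ) : DiscreteRows (rookPart k s) := by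
  constructor
  · rintro i j (h | ⟨h, -⟩)
    · exact Sum.inl_injective h
    · exact h
  · rintro i j (h | ⟨h, -⟩)
    · exact Sum.inr_injective h
    · exact h

theorem rookPart_inl_inr {s : ℕ} {i j : Fin k} :
    rookPart k s (Sum.inl i) (Sum.inr j) ↔ i = j ∧ s ≤ i := by
  constructor
  · rintro (h | h)
    · exact absurd h Sum.inl_ne_inr
    · exact h
  · exact fun h => Or.inr h

theorem mem_linked_rookPart {s : ℕ} {i : Fin k} : i ∈ linked (rookPart k s) ↔ s ≤ i := by
  simp [mem_linked, rookPart_inl_inr]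

theorem card_linked_rookPart {s : ℕ} (hs : s ≤ k) : (linked (rookPart k s)).card + s = k := by
  have h : linked (rookPart k s) = Finset.univ.filter fun i : Fin k => s ≤ i := by
    ext i
    simp [mem_linked_rookPart]
  rw [h]
  have h2 := Finset.card_filter_add_card_filter_not (s := (Finset.univ : Finset (Fin k)))
    (fun i => s ≤ i)
  have h3 : (Finset.univ.filter fun i : Fin k => ¬ s ≤ i).card = s := by
    simp only [not_le, Fin.card_filter_val_lt]
    omega
  rw [h3, Finset.card_univ, Fintype.card_fin] at h2
  exact h2

theorem eq_of_discreteRows {π ρ : SetPartition k} (hπ : DiscreteRows π) (hρ : DiscreteRows ρ)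
    (h : ∀ i j, π (Sum.inl i) (Sum.inr j) ↔ ρ (Sum.inl i) (Sum.inr j)) : π = ρ := by
  have key : ∀ {π ρ : SetPartition k}, DiscreteRows π →
      (∀ i j, π (Sum.inl i) (Sum.inr j) → ρ (Sum.inl i) (Sum.inr j)) → π ≤ ρ := by
    intro π ρ hπ h x y hxy
    rcases x with i | i <;> rcases y with j | j
    · rw [hπ.bottom hxy]
    · exact h _ _ hxy
    · exact ρ.symm (h _ _ (π.symm hxy))
    · rw [hπ.top hxy]
  exact le_antisymm (key hπ fun i j => (h i j).1) (key hρ fun i j => (h i j).2)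

/-- Two partial matchings with the same number of edges differ by permutations of the two rows,
which can be chosen to fix the frozen columns. -/
theorem exists_perm_rookPart {H : Set (Fin k)} {s : ℕ} {ρ : SetPartition k}
    (hρ : DiscreteRows ρ) (hHρ : Frozen H ρ) (hHs : Frozen H (rookPart k s))
    (hcard : (linked ρ).card = (linked (rookPart k s)).card) :
    ∃ σ τ : Equiv.Perm (Fin k), (∀ i ∈ H, σ i = i) ∧ (∀ i ∈ H, τ i = i) ∧
      Setoid.comap (Sum.map σ τ) (rookPart k s) = ρ := by
  classical
  have hH : ∀ i ∈ H, i ∈ linked (rookPart k s) := fun i hi => mem_linked.2 ⟨i, hHs i hi⟩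
  obtain ⟨g, hg⟩ := Set.MapsTo.exists_equiv_extend_of_card_eq
    (α := {i // i ∈ linked (rookPart k s)}) (t := linked ρ) (s := {i | i.1 ∈ H})
    (f := Subtype.val) (by rw [hcard, Fintype.card_coe])
    (fun i hi => mem_linked.2 ⟨i.1, hHρ i.1 hi⟩) Subtype.val_injective.injOn
  choose f hf using fun i : {i // i ∈ linked ρ} => mem_linked.1 i.2
  have hf_inj : Function.Injective f := fun i j hij =>
    Subtype.ext (hρ.bottom (ρ.trans (hf i) (hij ▸ ρ.symm (hf j))))
  -- Both permutations are found by extending injections that are given on the edges.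
  have hext : ∀ φ : {i // i ∈ linked (rookPart k s)} → Fin k, Function.Injective φ →
      ∃ σ : Equiv.Perm (Fin k), ∀ i, σ i.1 = φ i := by
    intro φ hφ
    obtain ⟨e, he⟩ := Set.MapsTo.exists_equiv_extend_of_card_eq (α := Fin k)
      (t := (Finset.univ : Finset (Fin k))) (s := {i | i ∈ linked (rookPart k s)})
      (f := fun i => if hi : i ∈ linked (rookPart k s) then φ ⟨i, hi⟩ else i)
      (by simp) (fun _ _ => by simp) (by
        intro i hi j hj hij
        simp only [Set.mem_ofPred_eq] at hi hj
        simp only [hi, hj, dif_pos] at hij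
        exact congrArg Subtype.val (hφ hij))
    refine ⟨e.trans (Equiv.subtypeUnivEquiv Finset.mem_univ), fun i => ?_⟩
    have := he i.1 i.2
    rw [dif_pos i.2] at this
    exact this
  obtain ⟨σ, hσ⟩ := hext (fun i => (g i).1) (Subtype.val_injective.comp g.injective)
  obtain ⟨τ, hτ⟩ := hext (fun i => f (g i)) (hf_inj.comp g.injective)
  have hσH : ∀ i ∈ H, σ i = i := fun i hi => (hσ ⟨i, hH i hi⟩).trans (hg ⟨i, hH i hi⟩ hi)
  have hτH : ∀ i ∈ H, τ i = i := by
    intro i hi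
    have h1 : (g ⟨i, hH i hi⟩).1 = i := hg ⟨i, hH i hi⟩ hi
    have h2 := hf (g ⟨i, hH i hi⟩)
    rw [h1] at h2
    rw [hτ ⟨i, hH i hi⟩]
    exact hρ.top (ρ.trans (ρ.symm h2) (hHρ i hi))
  refine ⟨σ.symm, τ.symm, fun i hi => ?_, fun i hi => ?_, ?_⟩
  · rw [Equiv.symm_apply_eq, hσH i hi]
  · rw [Equiv.symm_apply_eq, hτH i hi]
  · have hs := discreteRows_rookPart k s
    refine eq_of_discreteRows ⟨fun h => σ.symm.injective (hs.bottom h),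
      fun h => τ.symm.injective (hs.top h)⟩ hρ fun i j => ?_
    change rookPart k s (Sum.inl (σ.symm i)) (Sum.inr (τ.symm j)) ↔ _
    rw [rookPart_inl_inr, ← mem_linked_rookPart]
    constructor
    · rintro ⟨h1, h2⟩
      have h3 := hf (g ⟨_, h2⟩)
      rw [← hσ ⟨_, h2⟩, ← hτ ⟨_, h2⟩, Equiv.apply_symm_apply] at h3
      rwa [← τ.apply_symm_apply j, ← h1]
    · intro h
      have hi : i ∈ linked ρ := mem_linked.2 ⟨j, h⟩
      have h1 : σ.symm i = (g.symm ⟨i, hi⟩).1 := by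
        rw [Equiv.symm_apply_eq, hσ, Equiv.apply_symm_apply]
      have h2 : τ.symm j = (g.symm ⟨i, hi⟩).1 := by
        rw [Equiv.symm_apply_eq, hτ, Equiv.apply_symm_apply]
        exact hρ.top (ρ.trans (ρ.symm h) (hf ⟨i, hi⟩))
      exact ⟨h1.trans h2.symm, h1 ▸ (g.symm ⟨i, hi⟩).2⟩

theorem genPart_eq_rookPart (n k : ℕ) : genPart n k = rookPart k (n + 1 - k) := by
  rw [genPart]
  split_ifs with h
  · rfl
  · have h0 : n + 1 - k = 0 := by omega
    rw [h0]
    ext x y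
    constructor
    · exact fun hxy => Or.inr ⟨hxy, Nat.zero_le _⟩
    · rintro (rfl | ⟨hxy, -⟩)
      · rfl
      · exact hxy

theorem card_quotient_genPart {n k : ℕ} (h : n < 2 * k) :
    Nat.card (Quotient (genPart n k)) = max (n + 1) k := by
  have h1 := (discreteRows_rookPart k (n + 1 - k)).card_quotient_add
  have h2 := card_linked_rookPart (k := k) (s := n + 1 - k) (by omega)
  rw [genPart_eq_rookPart]
  omega

end Frozen

/-! ### Subspaces that are stable under multiplication by diagrams -/

section Stable

variable {F : Type*} [Field F] {k : ℕ} {ξ : F}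

/-- The subspace `J` is stable under left and right multiplication by all diagrams in which the
columns of `H` are frozen. -/
structure IsStable (H : Set (Fin k)) (J : Submodule F (PartitionAlgebra F k ξ)) : Prop where
  mul_left : ∀ {δ a}, Frozen H δ → a ∈ J → diagram ξ δ * a ∈ J
  mul_right : ∀ {δ a}, Frozen H δ → a ∈ J → a * diagram ξ δ ∈ J

variable {H : Set (Fin k)} {J : Submodule F (PartitionAlgebra F k ξ)}

theorem IsStable.flip (hJ : IsStable H J) : IsStable H (J.comap (flipLin F k ξ)) where
  mul_left {δ a} hδ ha := by
    rw [Submodule.mem_comap, flipLin_diagram_mul]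
    exact hJ.mul_right hδ.flip ha
  mul_right {δ a} hδ ha := by
    rw [Submodule.mem_comap, flipLin_mul_diagram]
    exact hJ.mul_left hδ.flip ha

theorem orbit_flip_mem {π : SetPartition k} :
    orbit ξ (flip π) ∈ J.comap (flipLin F k ξ) ↔ orbit ξ π ∈ J := by
  rw [Submodule.mem_comap, flipLin_orbit, flip_flip]

theorem IsStable.orbit_comap_top_mem (hJ : IsStable H J) {σ : Equiv.Perm (Fin k)}
    (hσ : ∀ i ∈ H, σ i = i) {π : SetPartition k} (h : orbit ξ π ∈ J) :
    orbit ξ (Setoid.comap (Sum.map id σ) π) ∈ J := by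
  rw [← permPart_mul_orbit]
  exact hJ.mul_left (frozen_permPart hσ) h

theorem IsStable.orbit_comap_mem (hJ : IsStable H J) {σ τ : Equiv.Perm (Fin k)}
    (hσ : ∀ i ∈ H, σ i = i) (hτ : ∀ i ∈ H, τ i = i) {π : SetPartition k} (h : orbit ξ π ∈ J) :
    orbit ξ (Setoid.comap (Sum.map σ τ) π) ∈ J := by
  have h1 := hJ.flip.orbit_comap_top_mem hσ (orbit_flip_mem.2 (hJ.orbit_comap_top_mem hτ h))
  have h2 : Setoid.comap (Sum.map id σ) (PartitionAlgebra.flip (Setoid.comap (Sum.map id τ) π)) =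
      PartitionAlgebra.flip (Setoid.comap (Sum.map σ τ) π) := by
    ext x y
    rcases x with x | x <;> rcases y with y | y <;> rfl
  rwa [h2, orbit_flip_mem] at h1

/-- A top vertex that shares its block with another top vertex may be isolated, as long as the
scalar that appears when it is moved back does not vanish. -/
theorem IsStable.orbit_mem_of_isolate (hJ : IsStable H J) {π : SetPartition k} {j u : Fin k}
    (hu : u ≠ j) (hju : π (Sum.inr j) (Sum.inr u)) (hj : j ∉ H)
    (hξ : ξ ≠ Nat.card (Quotient π)) (h : orbit ξ (isolate (Sum.inr j) π) ∈ J) :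
    orbit ξ π ∈ J := by
  have hu' : (Sum.inr u : Vertex k) ≠ Sum.inr j := fun h => hu (Sum.inr_injective h)
  have h1 := hJ.mul_left (frozen_joinPart H j u) (hJ.mul_left (frozen_cutPart hj) h)
  rw [joinPart_mul_cutPart_mul_orbit hu, if_pos (Setoid.isIsolated_isolate _ _),
    Setoid.card_quotient_isolate (Setoid.not_isIsolated hu' hju),
    ← Setoid.eq_attach hu' hju (Setoid.isolate_isolate _ _).symm, Nat.cast_succ] at h1
  refine (J.smul_mem_iff ?_).1 h1
  rw [sub_add_eq_sub_sub, sub_add_cancel]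
  exact sub_ne_zero.2 hξ

/-- Reduction to set partitions with discrete rows, by splitting vertices off their blocks. -/
theorem IsStable.orbit_mem_of_discreteRows [CharZero F] {n : ℕ}
    {J : Submodule F (PartitionAlgebra F k (n : F))} (hJ : IsStable H J) (hH : H.Subsingleton)
    (hrook : ∀ ρ : SetPartition k, Frozen H ρ → DiscreteRows ρ → n < Nat.card (Quotient ρ) →
      orbit (n : F) ρ ∈ J)
    (π : SetPartition k) (hπ : Frozen H π) (hn : n < Nat.card (Quotient π)) :
    orbit (n : F) π ∈ J := by
  induction hN : 2 * k - Nat.card (Quotient π) using Nat.strong_induction_on generalizing J π with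
  | _ N ih =>
    have hle : ∀ ρ : SetPartition k, Nat.card (Quotient ρ) ≤ 2 * k := by
      intro ρ
      refine (Nat.card_le_card_of_surjective _ (Quotient.mk_surjective (s := ρ))).trans ?_
      rw [Nat.card_eq_fintype_card, Fintype.card_sum, Fintype.card_fin, two_mul]
    have top : ∀ (J : Submodule F (PartitionAlgebra F k (n : F))), IsStable H J →
        (∀ ρ : SetPartition k, Frozen H ρ → DiscreteRows ρ → n < Nat.card (Quotient ρ) →
          orbit (n : F) ρ ∈ J) →
        ∀ π : SetPartition k, Frozen H π → n < Nat.card (Quotient π) →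
        2 * k - Nat.card (Quotient π) = N →
        ∀ i j, π (Sum.inr i) (Sum.inr j) → i ≠ j → orbit (n : F) π ∈ J := by
      intro J hJ hrook π hπ hn hN i j hij hne
      -- At most one of the two vertices is in a frozen column.
      wlog hi : i ∉ H generalizing i j
      · exact this j i (π.symm hij) hne.symm fun hj => hne (hH (not_not.1 hi) hj)
      have hji : (Sum.inr j : Vertex k) ≠ Sum.inr i := fun h => hne (Sum.inr_injective h).symm
      have hc := Setoid.card_quotient_isolate (Setoid.not_isIsolated hji hij)
      have hl := hle (isolate (Sum.inr i) π)
      exact hJ.orbit_mem_of_isolate hne.symm hij hi (by exact_mod_cast hn.ne)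
        (ih (2 * k - Nat.card (Quotient (isolate (Sum.inr i) π))) (by omega) hJ hrook _
          (hπ.isolate hi) (by omega) rfl)
    by_cases hd : DiscreteRows π
    · exact hrook π hπ hd hn
    by_cases ht : ∃ i j, π (Sum.inr i) (Sum.inr j) ∧ i ≠ j
    · obtain ⟨i, j, hij, hne⟩ := ht
      exact top J hJ hrook π hπ hn hN i j hij hne
    · obtain ⟨i, j, hij, hne⟩ : ∃ i j, π (Sum.inl i) (Sum.inl j) ∧ i ≠ j := by
        by_contra! hb
        push Not at ht
        exact hd ⟨fun {i j} => hb i j, fun {i j} => ht i j⟩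
      rw [← orbit_flip_mem]
      refine top _ hJ.flip (fun ρ h1 h2 h3 => ?_) (PartitionAlgebra.flip π) hπ.flip ?_ ?_ i j hij hne
      · rw [← flip_flip ρ, orbit_flip_mem]
        exact hrook _ h1.flip h2.flip (by rwa [card_quotient_flip])
      · rwa [card_quotient_flip]
      · rwa [card_quotient_flip]

/-- Partial matchings with few edges are obtained from `rookPart k s`, up to permutations, by
removing edges one at a time. -/
theorem IsStable.orbit_mem_of_rookPart (hJ : IsStable H J) {s : ℕ}
    (hs : Frozen H (rookPart k s)) (hmem : orbit ξ (rookPart k s) ∈ J) (ρ : SetPartition k)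
    (hρ : Frozen H ρ) (hd : DiscreteRows ρ)
    (hcard : Nat.card (Quotient (rookPart k s)) ≤ Nat.card (Quotient ρ)) : orbit ξ ρ ∈ J := by
  classical
  induction hN : Nat.card (Quotient ρ) using Nat.strong_induction_on generalizing ρ with
  | _ N ih =>
    have h1 := hd.card_quotient_add
    have h2 := (discreteRows_rookPart k s).card_quotient_add
    rcases hcard.eq_or_lt with heq | hlt
    · obtain ⟨σ, τ, hσ, hτ, rfl⟩ := exists_perm_rookPart hd hρ hs (by omega)
      exact hJ.orbit_comap_mem hσ hτ hmem
    have h3 : (linked (rookPart k s)).card ≤ k := by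
      simpa using (linked (rookPart k s)).card_le_univ
    have hex : ∀ A : Finset (Fin k), A.card < k → ∃ i, i ∉ A := by
      intro A hA
      by_contra! h
      rw [Finset.eq_univ_of_forall h, Finset.card_univ, Fintype.card_fin] at hA
      exact lt_irrefl _ hA
    obtain ⟨i, hi⟩ := hex (linked ρ) (by omega)
    obtain ⟨j, hj⟩ := hex (linked (PartitionAlgebra.flip ρ)) (by
      rw [hd.card_linked_flip]; omega)
    have hiso : IsIsolated (Sum.inr j) ρ := by
      rintro (x | x) hx
      · exact absurd ((mem_linked (π := PartitionAlgebra.flip ρ)).2 ⟨x, hx⟩) hj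
      · rw [hd.top hx]
    have hjH := hρ.notMem_of_isIsolated hiso
    have hij : (Sum.inl i : Vertex k) ≠ Sum.inr j := Sum.inl_ne_inr
    -- The edge from `i` to `j` is put in, and cut again.
    set π := attach (Sum.inr j) (Sum.inl i) ρ with hπdef
    have hπ : isolate (Sum.inr j) π = ρ := (Setoid.isolate_attach _ _ _).trans hiso.isolate_eq
    have hπv : ¬ IsIsolated (Sum.inr j) π :=
      Setoid.not_isIsolated hij (Setoid.attach_rel ρ hij)
    have hrook : ∀ τ : SetPartition k, isolate (Sum.inr j) τ = ρ → τ ≠ ρ →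
        (∀ u, u ≠ j → ¬ τ (Sum.inr j) (Sum.inr u)) → orbit ξ τ ∈ J := by
      intro τ hτ hne hu
      have hτv : ¬ IsIsolated (Sum.inr j) τ := fun h => hne (h.isolate_eq.symm.trans hτ)
      have hc := Setoid.card_quotient_isolate hτv
      rw [hτ] at hc
      refine ih (Nat.card (Quotient τ)) (by omega) τ
        (hρ.mono (hτ ▸ Setoid.isolate_le _ _)) ⟨?_, ?_⟩ (by omega) rfl
      · intro a b hab
        refine hd.bottom ?_
        rw [← hτ]
        exact Or.inr ⟨Sum.inl_ne_inr, Sum.inl_ne_inr, hab⟩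
      · intro a b hab
        by_cases ha : a = j
        · subst ha
          by_contra hne
          exact hu b (Ne.symm hne) hab
        by_cases hb : b = j
        · subst hb
          exact absurd (τ.symm hab) (hu a ha)
        refine hd.top ?_
        rw [← hτ]
        exact Or.inr ⟨fun h => ha (Sum.inr_injective h), fun h => hb (Sum.inr_injective h), hab⟩
    have hπJ : orbit ξ π ∈ J := by
      refine hrook π hπ (fun h => hπv (h.symm ▸ hiso)) fun u hu h => hi (mem_linked.2 ⟨u, ?_⟩)
      exact (Setoid.attach_apply_left fun h => hu (Sum.inr_injective h)).1 h
    have hsum := hJ.mul_left (frozen_cutPart hjH) hπJ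
    have hρmem : ρ ∈ Finset.univ.filter fun τ : SetPartition k => isolate (Sum.inr j) τ = ρ := by
      simpa using hiso.isolate_eq
    rw [cutPart_mul_orbit, if_neg hπv, one_smul, hπ, ← Finset.add_sum_erase _ _ hρmem] at hsum
    refine (J.add_mem_iff_left (J.sum_mem fun τ hτ => ?_)).1 hsum
    simp only [Finset.mem_erase, Finset.mem_filter, Finset.mem_univ, true_and] at hτ
    obtain ⟨hne, hτ⟩ := hτ
    by_cases hu : ∃ u, u ≠ j ∧ τ (Sum.inr j) (Sum.inr u)
    · obtain ⟨u, huj, hu⟩ := hu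
      have huj' : (Sum.inr u : Vertex k) ≠ Sum.inr j := fun h => huj (Sum.inr_injective h)
      have h := hJ.mul_left (frozen_joinPart H j u) (hJ.mul_left (frozen_cutPart hjH) hπJ)
      rwa [joinPart_mul_cutPart_mul_orbit huj, if_neg hπv, one_smul,
        ← Setoid.eq_attach huj' hu (hτ.trans hπ.symm)] at h
    · push Not at hu
      exact hrook τ hτ hne hu

/-- A stable subspace that contains the generator contains all orbit basis elements of set
partitions with more than `n` blocks. -/
theorem IsStable.orbit_mem_of_gen_mem [CharZero F] {n : ℕ}
    {J : Submodule F (PartitionAlgebra F k (n : F))} (hJ : IsStable H J) (hH : H.Subsingleton)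
    (hk : n < 2 * k) (hgen : Frozen H (genPart n k)) (hmem : gen F n k ∈ J)
    (π : SetPartition k) (hπ : Frozen H π) (hn : n < Nat.card (Quotient π)) :
    orbit (n : F) π ∈ J := by
  have hc := card_quotient_genPart hk
  rw [gen] at hmem
  rw [genPart_eq_rookPart] at hc hgen hmem
  refine hJ.orbit_mem_of_discreteRows hH (fun ρ h1 h2 h3 => ?_) π hπ hn
  refine hJ.orbit_mem_of_rookPart hgen hmem ρ h1 h2 ?_
  have h4 := h2.card_quotient_add
  have h5 : (linked ρ).card ≤ k := by simpa using (linked ρ).card_le_univ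
  omega

end Stable

/-! ### The kernel in terms of the orbit basis -/

section Kernel

variable {F : Type*} [Field F] {k : ℕ}

theorem exists_sum_orbit {ξ : F} {H : Set (Fin k)} {a : PartitionAlgebra F k ξ}
    (ha : a ∈ Submodule.span F (diagram ξ '' {π | Frozen H π})) :
    ∃ c : SetPartition k → F, (∀ π, ¬ Frozen H π → c π = 0) ∧ a = ∑ π, c π • orbit ξ π := by
  classical
  induction ha using Submodule.span_induction with
  | mem x hx =>
    obtain ⟨π, hπ, rfl⟩ := hx
    refine ⟨fun ρ => if π ≤ ρ then 1 else 0, fun ρ hρ => if_neg fun h => hρ (Frozen.mono hπ h), ?_⟩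
    simp only [ite_smul, one_smul, zero_smul]
    rw [diagram_eq_sum_orbit, Finset.sum_filter]
  | zero => exact ⟨0, fun _ _ => rfl, by simp⟩
  | add x y _ _ hx hy =>
    obtain ⟨c, hc, rfl⟩ := hx
    obtain ⟨d, hd, rfl⟩ := hy
    exact ⟨c + d, fun π hπ => by simp [hc π hπ, hd π hπ], by
      simp [add_smul, Finset.sum_add_distrib]⟩
  | smul r x _ hx =>
    obtain ⟨c, hc, rfl⟩ := hx
    exact ⟨r • c, fun π hπ => by simp [hc π hπ], by simp [Finset.smul_sum, mul_smul]⟩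

/-- The matrix entries of an element are its coefficients in the orbit basis. -/
theorem matrixRep_sum_orbit (n : ℕ) (c : SetPartition k → F) (t b : Fin k → Fin n) :
    matrixRep F n k (∑ π, c π • orbit (n : F) π) t b = c (Setoid.ker (Sum.elim b t)) := by
  classical
  have h : ∀ π : SetPartition k, (∀ x y, Sum.elim b t x = Sum.elim b t y ↔ π x y) ↔
      π = Setoid.ker (Sum.elim b t) := fun π =>
    ⟨fun h => Setoid.ext fun x y => (h x y).symm, by rintro rfl x y; rfl⟩
  simp only [map_sum, map_smul, Matrix.sum_apply, Matrix.smul_apply, matrixRep_orbit, h]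
  simp

theorem matrixRep_orbit_eq_zero {n : ℕ} {π : SetPartition k} (hn : n < Nat.card (Quotient π)) :
    matrixRep F n k (orbit (n : F) π) = 0 := by
  classical
  ext t b
  rw [matrixRep_orbit, if_neg, Matrix.zero_apply]
  intro h
  refine hn.not_ge ?_
  have hinj : Function.Injective
      (Quotient.lift (s := π) (Sum.elim b t) fun x y hxy => (h x y).2 hxy) := by
    intro p q
    induction p using Quotient.inductionOn with
    | _ x =>
      induction q using Quotient.inductionOn with
      | _ y => exact fun hxy => Quotient.sound ((h x y).1 hxy)
  simpa using Nat.card_le_card_of_injective _ hinj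

theorem exists_ker_eq {V : Type*} [Finite V] {n : ℕ} {π : Setoid V}
    (hn : Nat.card (Quotient π) ≤ n) (x : V) (j : Fin n) :
    ∃ f : V → Fin n, Setoid.ker f = π ∧ f x = j := by
  obtain ⟨e⟩ : Nonempty (Quotient π ↪ Fin n) := by
    have := Fintype.ofFinite (Quotient π)
    exact Function.Embedding.nonempty_of_card_le (by
      rwa [Fintype.card_fin, ← Nat.card_eq_fintype_card])
  refine ⟨fun y => Equiv.swap (e (Quotient.mk π x)) j (e (Quotient.mk π y)), ?_, by simp⟩
  ext y z
  simp [Setoid.ker_def, Quotient.eq]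

variable {n : ℕ} {H : Set (Fin k)} {J : Submodule F (PartitionAlgebra F k (n : F))}

/-- An element lies in a stable subspace that contains the generator as soon as its matrix vanishes
at all labelings which agree exactly on the blocks of some set partition with at most `n` blocks;
it suffices to have one such labeling for each set partition. -/
theorem IsStable.mem_of_matrixRep [CharZero F] (hJ : IsStable H J) (hH : H.Subsingleton)
    (hk : n < 2 * k) (hgen : Frozen H (genPart n k)) (hmem : gen F n k ∈ J)
    {a : PartitionAlgebra F k (n : F)}
    (ha : a ∈ Submodule.span F (diagram (n : F) '' {π | Frozen H π}))
    (h : ∀ π, Frozen H π → Nat.card (Quotient π) ≤ n → ∃ t b : Fin k → Fin n,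
      Setoid.ker (Sum.elim b t) = π ∧ matrixRep F n k a t b = 0) : a ∈ J := by
  obtain ⟨c, hc, rfl⟩ := exists_sum_orbit ha
  refine J.sum_mem fun π _ => ?_
  by_cases hπ : Frozen H π
  · rcases le_or_gt (Nat.card (Quotient π)) n with hn | hn
    · obtain ⟨t, b, rfl, h0⟩ := h π hπ hn
      rw [matrixRep_sum_orbit] at h0
      rw [h0, zero_smul]
      exact J.zero_mem
    · exact J.smul_mem _ (hJ.orbit_mem_of_gen_mem hH hk hgen hmem π hπ hn)
  · rw [hc π hπ, zero_smul]
    exact J.zero_mem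

theorem matrixRep_gen (F : Type*) [Field F] (hk : n < 2 * k) : matrixRep F n k (gen F n k) = 0 :=
  matrixRep_orbit_eq_zero (by rw [card_quotient_genPart hk]; omega)

/-- A two-sided ideal of an algebra as a linear subspace. -/
def idealSubmodule (F : Type*) [Field F] {A : Type*} [Ring A] [Algebra F A]
    (I : TwoSidedIdeal A) : Submodule F A where
  carrier := {x | x ∈ I}
  add_mem' := I.add_mem
  zero_mem' := I.zero_mem
  smul_mem' r x hx := Algebra.smul_def r x ▸ I.mul_mem_left _ _ hx

theorem mem_idealSubmodule {A : Type*} [Ring A] [Algebra F A] {I : TwoSidedIdeal A} {x : A} :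
    x ∈ idealSubmodule F I ↔ x ∈ I := Iff.rfl

theorem isStable_map_idealSubmodule {ξ : F} {S : Subalgebra F (PartitionAlgebra F k ξ)}
    (hS : ∀ δ, Frozen H δ → diagram ξ δ ∈ S) (I : TwoSidedIdeal S) :
    IsStable H ((idealSubmodule F I).map S.val.toLinearMap) := by
  constructor
  · rintro δ _ hδ ⟨x, hx, rfl⟩
    have h := I.mul_mem_left ⟨_, hS δ hδ⟩ x hx
    exact Submodule.mem_map.2 ⟨_, mem_idealSubmodule.2 h, map_mul S.val _ _⟩
  · rintro δ _ hδ ⟨x, hx, rfl⟩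
    have h := I.mul_mem_right x ⟨_, hS δ hδ⟩ hx
    exact Submodule.mem_map.2 ⟨_, mem_idealSubmodule.2 h, map_mul S.val _ _⟩

theorem isStable_idealSubmodule {ξ : F} (I : TwoSidedIdeal (PartitionAlgebra F k ξ)) :
    IsStable H (idealSubmodule F I) := by
  constructor
  · intro δ a _ ha
    exact I.mul_mem_left (diagram ξ δ) a ha
  · intro δ a _ ha
    exact I.mul_mem_right a (diagram ξ δ) ha

theorem Phi_eq_zero_iff {a : PartitionAlgebra F k (n : F)} :
    Phi F n k a = 0 ↔ matrixRep F n k a = 0 :=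
  EmbeddingLike.map_eq_zero_iff (f := Matrix.toLinAlgEquiv (tensorBasis F n k))

theorem ker_Phi [CharZero F] (hn : 1 ≤ n) (hk : n < 2 * k) :
    TwoSidedIdeal.ker (Phi F n k) = TwoSidedIdeal.span {gen F n k} := by
  apply le_antisymm
  · intro a ha
    rw [TwoSidedIdeal.mem_ker, Phi_eq_zero_iff] at ha
    let J : Submodule F (PartitionAlgebra F k (n : F)) :=
      idealSubmodule F (TwoSidedIdeal.span {gen F n k})
    have hJ : IsStable (∅ : Set (Fin k)) J := isStable_idealSubmodule _
    refine hJ.mem_of_matrixRep Set.subsingleton_empty hk (fun _ h => h.elim)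
      (TwoSidedIdeal.subset_span rfl) ?_ fun π _ hπ => ?_
    · have h : diagram (n : F) '' {π : SetPartition k | Frozen ∅ π} =
          Set.range (diagramBasis F k (n : F)) := by
        rw [← Set.image_univ]
        congr 1
        exact Set.eq_univ_of_forall fun π i hi => hi.elim
      rw [h, Module.Basis.span_eq]
      exact Submodule.mem_top
    · obtain ⟨f, rfl, -⟩ := exists_ker_eq hπ (Sum.inl ⟨0, by omega⟩) ⟨0, hn⟩
      exact ⟨f ∘ Sum.inr, f ∘ Sum.inl, by rw [Sum.elim_comp_inl_inr], by rw [ha]; rfl⟩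
  · rw [TwoSidedIdeal.span_le, Set.singleton_subset_iff, SetLike.mem_coe, TwoSidedIdeal.mem_ker,
      Phi_eq_zero_iff]
    exact matrixRep_gen F hk

theorem PhiHalf_eq_zero_iff (hn : 1 ≤ n) {a : halfAlgebra F k (n : F)} :
    PhiHalf F n k hn a = 0 ↔ matrixRepHalf F n k ⟨n - 1, Nat.sub_lt hn Nat.one_pos⟩ a = 0 :=
  EmbeddingLike.map_eq_zero_iff (f := Matrix.toLinAlgEquiv (tensorBasis F n k))

theorem ker_PhiHalf [CharZero F] (hn : 1 ≤ n) (hk : n < 2 * k + 1) :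
    TwoSidedIdeal.ker (PhiHalf F n k hn) = TwoSidedIdeal.span {genHalf F n k hk} := by
  have hk' : n < 2 * (k + 1) := by omega
  have hF : ∀ π : SetPartition (k + 1), Frozen {Fin.last k} π ↔ IsHalf π := by
    intro π
    simp [Frozen, IsHalf]
  have hd : ∀ δ : SetPartition (k + 1), Frozen {Fin.last k} δ →
      diagram (n : F) δ ∈ halfAlgebra F k (n : F) :=
    fun δ hδ => Submodule.subset_span ⟨δ, (hF δ).1 hδ, rfl⟩
  apply le_antisymm
  · intro a ha
    rw [TwoSidedIdeal.mem_ker, PhiHalf_eq_zero_iff] at ha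
    let J : Submodule F (PartitionAlgebra F (k + 1) (n : F)) :=
      (idealSubmodule F (TwoSidedIdeal.span {genHalf F n k hk})).map
        (halfAlgebra F k (n : F)).val.toLinearMap
    have hJ : IsStable {Fin.last k} J := isStable_map_idealSubmodule hd _
    have hgen : gen F n (k + 1) ∈ J :=
      Submodule.mem_map_of_mem (f := (halfAlgebra F k (n : F)).val.toLinearMap)
        (mem_idealSubmodule.2 (TwoSidedIdeal.subset_span (Set.mem_singleton _)))
    have hmem : a.1 ∈ J := by
      refine hJ.mem_of_matrixRep Set.subsingleton_singleton hk' ((hF _).2 (isHalf_genPart hk))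
        hgen ?_ fun π hHπ hπ => ?_
      · have h : {π : SetPartition (k + 1) | Frozen {Fin.last k} π} = {π | IsHalf π} :=
          Set.ext hF
        rw [h]
        exact a.2
      · -- The label of the frozen column is the one that `PhiHalf` fixes.
        obtain ⟨f, rfl, hf⟩ := exists_ker_eq hπ (Sum.inl (Fin.last k))
          ⟨n - 1, Nat.sub_lt hn Nat.one_pos⟩
        have hf' : f (Sum.inr (Fin.last k)) = ⟨n - 1, Nat.sub_lt hn Nat.one_pos⟩ :=
          ((hF _).1 hHπ).symm.trans hf
        refine ⟨f ∘ Sum.inr, f ∘ Sum.inl, by rw [Sum.elim_comp_inl_inr], ?_⟩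
        have h := congrFun (congrFun ha (Fin.init (f ∘ Sum.inr))) (Fin.init (f ∘ Sum.inl))
        change matrixRep F n (k + 1) a.1 (Fin.snoc (Fin.init (f ∘ Sum.inr)) _)
          (Fin.snoc (Fin.init (f ∘ Sum.inl)) _) = 0 at h
        have h1 : (Fin.snoc (Fin.init (f ∘ Sum.inr)) ⟨n - 1, Nat.sub_lt hn Nat.one_pos⟩ :
            Fin (k + 1) → Fin n) = f ∘ Sum.inr := by
          rw [← hf']
          exact Fin.snoc_init_self (f ∘ Sum.inr)
        have h2 : (Fin.snoc (Fin.init (f ∘ Sum.inl)) ⟨n - 1, Nat.sub_lt hn Nat.one_pos⟩ :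
            Fin (k + 1) → Fin n) = f ∘ Sum.inl := by
          rw [← hf]
          exact Fin.snoc_init_self (f ∘ Sum.inl)
        rwa [h1, h2] at h
    obtain ⟨x, hx, hxa⟩ := hmem
    rwa [← Subtype.ext (a1 := x) (a2 := a) hxa]
  · rw [TwoSidedIdeal.span_le, Set.singleton_subset_iff, SetLike.mem_coe, TwoSidedIdeal.mem_ker,
      PhiHalf_eq_zero_iff]
    ext t b
    change matrixRep F n (k + 1) (gen F n (k + 1)) _ _ = 0
    rw [matrixRep_gen F hk']
    rfl

end Kernel

end PartitionAlgebra

theorem theorem5p6 (F : Type*) [Field F] [CharZero F] (n : ℕ) (hn : 1 ≤ n) :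
    (∀ k : ℕ, 1 ≤ k → n < 2 * k →
      TwoSidedIdeal.ker (PartitionAlgebra.Phi F n k) =
        TwoSidedIdeal.span {PartitionAlgebra.gen F n k}) ∧
    (∀ (k : ℕ) (h : n < 2 * k + 1),
      TwoSidedIdeal.ker (PartitionAlgebra.PhiHalf F n k hn) =
        TwoSidedIdeal.span {PartitionAlgebra.genHalf F n k h}) :=
  ⟨fun _ _ hk => PartitionAlgebra.ker_Phi hn hk, fun _ hk => PartitionAlgebra.ker_PhiHalf hn hk⟩
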